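/- Let $n\ge 4$. For $k\ge 3$ let $\mathcal M_{0,k,\mathrm{trop}}$ be the set of isomorphism classes of $k$-marked rational tropical curves $(\Gamma,x_1,\dots,x_k)$: finite metric trees $\Gamma$ whose bounded edges have positive real lengths, with exactly $k$ unbounded edges, labelled $x_1,\dots,x_k$, and with all vertices of valence at least $3$ (isomorphisms preserve lengths and labels). Let $\mathrm{dist}_k(\Gamma)\in\mathbb R^{\binom k2}$ be the vector of the distances between $x_i$ and $x_j$ (the sum of the lengths of the bounded edges on the path from $x_i$ to $x_j$) for $\{i,j\}\subset[k]$, let $\Phi_k:\mathbb R^k\to\mathbb R^{\binom k2}$, $a\mapsto(a_i+a_j)_{\{i,j\}}$, let $Q_k=\mathbb R^{\binom k2}/\operatorname{im}\Phi_k$ with projection $q_k$, and put $\varphi_k=q_k\circ\mathrm{dist}_k:\mathcal M_{0,k,\mathrm{trop}}\to Q_k$. For $I\subset[k]$ with $1<|I|<k-1$ let $v_I\in Q_k$ be the image under $\varphi_k$ of the curve with exactly one bounded edge, of length $1$, that has the ends labelled by $I$ on one side and the other ends on the other side, and let $\Lambda_k\subset Q_k$ be the subgroup generated by all $v_I$.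 Let $X_k$ be the set of the cones in $Q_k$ of all combinatorial types of $k$-marked curves, where the cone of a type is the set of all $q_k(\mathrm{dist}_k)$ obtained by giving the bounded edges of a tree of this type arbitrary lengths $\ge 0$. Let $\mathrm{ft}:\mathcal M_{0,n,\mathrm{trop}}\to\mathcal M_{0,n-1,\mathrm{trop}}$ be the forgetful map, which removes the end $x_n$ and straightens the $2$-valent vertex that possibly emerges. Then the following holds. 1. The projection $\mathbb R^{\binom n2}\to\mathbb R^{\binom{n-1}2}$ to the coordinates $T$ with $n\notin T$ induces a linear map $\widetilde{\mathrm{pr}}:Q_n\to Q_{n-1}$, and $\widetilde{\mathrm{pr}}\circ\varphi_n=\varphi_{n-1}\circ\mathrm{ft}$. 2. $\widetilde{\mathrm{pr}}(\Lambda_n)\subset\Lambda_{n-1}$. 3. The forgetful map is a morphism of fans. That is: for $k\in\{n-1,n\}$ the group $\Lambda_k$ is a lattice in $Q_k$ (generated by an $\mathbb R$-basis of $Q_k$), and $X_k$ is a fan in $Q_k$ with respect to $\Lambda_k$ (a finite set of cones, each given by finitely many linear equalities and non-strict inequalities that are integral on $\Lambda_k$, that contains all faces of its cones and in which the intersection of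 any two cones is a face of each) with support $|X_k|=\varphi_k(\mathcal M_{0,k,\mathrm{trop}})$; and there is a map $f:|X_n|\to|X_{n-1}|$ with $f(\varphi_n(C))=\varphi_{n-1}(\mathrm{ft}(C))$ for all $C\in\mathcal M_{0,n,\mathrm{trop}}$ that is the restriction of the linear map $\widetilde{\mathrm{pr}}$, which maps $\Lambda_n$ into $\Lambda_{n-1}$. -/

import Mathlib

namespace TropM0n

/-! ### Cones, fans and their morphisms -/

section Fans

variable {V V' : Type} [AddCommGroup V] [Module ℝ V] [AddCommGroup V'] [Module ℝ V']

/-- `L` is a lattice in the real vector space `V`: it is the group of integral combinations of a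
finite `ℝ`-basis of `V`. Equivalently `L` is a finitely generated free abelian group and
`V = L ⊗ ℝ`. -/
def IsLattice (L : AddSubgroup V) : Prop :=
  ∃ (ι : Type) (_ : Finite ι) (b : Module.Basis ι ℝ V), L = AddSubgroup.closure (Set.range b)

/-- The dual lattice: the linear forms on `V` that take integral values on `L`. -/
def dualLattice (L : AddSubgroup V) : Set (V →ₗ[ℝ] ℝ) :=
  {f | ∀ x ∈ L, ∃ k : ℤ, f x = k}

/-- The set cut out by the equalities `f = 0`, `f ∈ F`, and the inequalities `g ≥ 0`, `g ∈ G`. -/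
def solutionSet (F G : Set (V →ₗ[ℝ] ℝ)) : Set V :=
  {x | (∀ f ∈ F, f x = 0) ∧ ∀ g ∈ G, 0 ≤ g x}

/-- A cone: a set given by finitely many linear integral equalities and non-strict inequalities. -/
def IsCone (L : AddSubgroup V) (σ : Set V) : Prop :=
  ∃ F G : Set (V →ₗ[ℝ] ℝ), F.Finite ∧ G.Finite ∧ F ⊆ dualLattice L ∧ G ⊆ dualLattice L ∧
    σ = solutionSet F G

/-- `τ` is a face of the cone `σ`: it is obtained from a description of `σ` by finitely many
integral equalities and inequalities by turning some of the inequalities into equalities. -/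
def IsFace (L : AddSubgroup V) (τ σ : Set V) : Prop :=
  ∃ F G J : Set (V →ₗ[ℝ] ℝ), F.Finite ∧ G.Finite ∧ F ⊆ dualLattice L ∧ G ⊆ dualLattice L ∧
    J ⊆ G ∧ σ = solutionSet F G ∧ τ = solutionSet (F ∪ J) (G \ J)

/-- A fan in `V` (with lattice `L`): a finite set of cones that contains all faces of its cones
and in which any two cones intersect in a common face. -/
structure IsFan (L : AddSubgroup V) (X : Set (Set V)) : Prop where
  finite : X.Finite
  isCone : ∀ σ ∈ X, IsCone L σ
  face_mem : ∀ σ ∈ X, ∀ τ, IsFace L τ σ → τ ∈ X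
  inter_face_left : ∀ σ ∈ X, ∀ σ' ∈ X, IsFace L (σ ∩ σ') σ
  inter_face_right : ∀ σ ∈ X, ∀ σ' ∈ X, IsFace L (σ ∩ σ') σ'

/-- The support `|X|` of a fan: the union of its cones. -/
def support (X : Set (Set V)) : Set V := ⋃₀ X

/-- `f : |X| → |Y|` is a morphism from the fan `X` in `V` (with lattice `L`) to the fan `Y` in `V'`
(with lattice `L'`): it is the restriction of a linear map `V → V'` that maps `L` to `L'`. -/
structure IsFanMorphism (L : AddSubgroup V) (X : Set (Set V)) (L' : AddSubgroup V')
    (Y : Set (Set V')) (f : support X → support Y) : Prop where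
  isLattice_source : IsLattice L
  isLattice_target : IsLattice L'
  isFan_source : IsFan L X
  isFan_target : IsFan L' Y
  exists_linear : ∃ F : V →ₗ[ℝ] V', (∀ x ∈ L, F x ∈ L') ∧ ∀ x : support X, (f x : V') = F x

end Fans

/-! ### Marked rational tropical curves -/

/-- The valence of the vertex `v` of a graph with bounded edges `G` and with one unbounded edge
attached at `leg i` for every label `i`: the number of flags at `v`. -/
noncomputable def valence {V : Type} {n : ℕ} (G : SimpleGraph V) (leg : Fin n → V) (v : V) : ℕ :=
  (G.neighborSet v).ncard + {i | leg i = v}.ncard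

/-- The combinatorial data of an `n`-marked rational tropical curve with precisely `n` unbounded
edges: a finite tree `G` of vertices and bounded edges (connected of genus `0`), and for each label
`i` the vertex `leg i` at which the unbounded edge `x_i` is attached, all vertices having valence
at least `3`. -/
structure CombType (n : ℕ) where
  V : Type
  finite : Finite V
  G : SimpleGraph V
  isTree : G.IsTree
  leg : Fin n → V
  stable : ∀ v, 3 ≤ valence G leg v

/-- An `n`-marked rational tropical curve with precisely `n` unbounded edges: in addition each
bounded edge has a positive length. (The values of `len` outside `G.edgeSet` are irrelevant.) -/
structure Curve (n : ℕ) extends CombType n where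
  len : Sym2 V → ℝ
  len_pos : ∀ e ∈ G.edgeSet, 0 < len e

variable {n : ℕ}

/-- Isomorphisms of marked tropical curves: length-preserving isomorphisms of the trees that
respect the marked unbounded edges. -/
def Curve.Iso (C D : Curve n) : Prop :=
  ∃ φ : C.G ≃g D.G, (∀ i, φ (C.leg i) = D.leg i) ∧
    ∀ e ∈ C.G.edgeSet, D.len (Sym2.map φ e) = C.len e

lemma Curve.Iso.refl (C : Curve n) : C.Iso C :=
  ⟨SimpleGraph.Iso.refl, fun _ => rfl, fun e _ => by
    change C.len (Sym2.map id e) = _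
    simp⟩

lemma Curve.Iso.symm {C D : Curve n} (h : C.Iso D) : D.Iso C := by
  obtain ⟨φ, h1, h2⟩ := h
  refine ⟨φ.symm, fun i => by rw [← h1]; simp, fun e he => ?_⟩
  have key : Sym2.map φ (Sym2.map φ.symm e) = e := by
    rw [Sym2.map_map]
    have : (φ ∘ φ.symm : D.V → D.V) = id := by ext; simp
    rw [this]; simp
  rw [← h2, key]
  induction e using Sym2.ind with
  | _ a b =>
    simp only [Sym2.map_mk, SimpleGraph.mem_edgeSet] at he ⊢
    exact φ.symm.map_adj_iff.2 he

lemma Curve.Iso.trans {C D E : Curve n} (h : C.Iso D) (h' : D.Iso E) : C.Iso E := by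
  obtain ⟨φ, h1, h2⟩ := h
  obtain ⟨ψ, h3, h4⟩ := h'
  refine ⟨φ.trans ψ, fun i => by simp [h1, h3], fun e he => ?_⟩
  rw [← h2 e he, ← h4]
  · rw [Sym2.map_map]; rfl
  · induction e using Sym2.ind with
    | _ a b =>
      simp only [Sym2.map_mk, SimpleGraph.mem_edgeSet] at he ⊢
      exact φ.map_adj_iff.2 he

instance curveSetoid (n : ℕ) : Setoid (Curve n) where
  r := Curve.Iso
  iseqv := ⟨Curve.Iso.refl, Curve.Iso.symm, Curve.Iso.trans⟩

/-- The moduli space `M_{0,n,trop}` of `n`-marked rational tropical curves up to isomorphism. -/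
def M0n (n : ℕ) : Type 1 := Quotient (curveSetoid n)

/-! ### Distances and the space `Q_n` -/

/-- The sum of the lengths of the edges on the unique path from `u` to `v`. -/
noncomputable def CombType.pathLength (T : CombType n) (len : Sym2 T.V → ℝ) (u v : T.V) : ℝ :=
  ((T.isTree.existsUnique_path u v).choose.edges.map len).sum

lemma CombType.pathLength_eq (T : CombType n) (len : Sym2 T.V → ℝ) {u v : T.V}
    (p : T.G.Walk u v) (hp : p.IsPath) : T.pathLength len u v = (p.edges.map len).sum := by
  rw [CombType.pathLength, (T.isTree.existsUnique_path u v).unique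
    (T.isTree.existsUnique_path u v).choose_spec.1 hp]

lemma CombType.pathLength_comm (T : CombType n) (len : Sym2 T.V → ℝ) (u v : T.V) :
    T.pathLength len u v = T.pathLength len v u := by
  obtain ⟨p, hp, -⟩ := T.isTree.existsUnique_path v u
  rw [T.pathLength_eq len p hp, T.pathLength_eq len p.reverse hp.reverse,
    SimpleGraph.Walk.edges_reverse, List.map_reverse, List.sum_reverse]

/-- The index set of the coordinates: the two-element subsets `{i, j}` of the set of labels. -/
abbrev Pairs (n : ℕ) : Type := {T : Sym2 (Fin n) // ¬ T.IsDiag}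

/-- The vector of the distances `dist(x_i, x_j)` between the unbounded edges. -/
noncomputable def CombType.distVec (T : CombType n) (len : Sym2 T.V → ℝ) : Pairs n → ℝ :=
  fun p => Sym2.lift ⟨fun i j => T.pathLength len (T.leg i) (T.leg j),
    fun _ _ => T.pathLength_comm len _ _⟩ p.1

/-- The linear map `Φ_n : ℝ^n → ℝ^(n choose 2)`, `a ↦ (a_i + a_j)_{i,j}`. -/
def Phi (n : ℕ) : (Fin n → ℝ) →ₗ[ℝ] (Pairs n → ℝ) where
  toFun a p := Sym2.lift ⟨fun i j => a i + a j, fun _ _ => add_comm _ _⟩ p.1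
  map_add' a b := by
    funext ⟨p, hp⟩
    induction p using Sym2.ind with
    | _ i j => simp; ring
  map_smul' c a := by
    funext ⟨p, hp⟩
    induction p using Sym2.ind with
    | _ i j => simp; ring

/-- The quotient space `Q_n` of `ℝ^(n choose 2)` by the image of `Φ_n`. -/
abbrev Q (n : ℕ) : Type := (Pairs n → ℝ) ⧸ LinearMap.range (Phi n)

/-- The canonical projection `q_n`. -/
def q (n : ℕ) : (Pairs n → ℝ) →ₗ[ℝ] Q n := (LinearMap.range (Phi n)).mkQ

lemma Curve.Iso.distVec_eq {C D : Curve n} (h : C.Iso D) :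
    C.distVec C.len = D.distVec D.len := by
  obtain ⟨φ, h1, h2⟩ := h
  funext ⟨p, hp⟩
  induction p using Sym2.ind with
  | _ i j =>
    simp only [CombType.distVec, Sym2.lift_mk]
    obtain ⟨w, hw, -⟩ := C.isTree.existsUnique_path (C.leg i) (C.leg j)
    have key := D.pathLength_eq D.len (w.map φ.toHom) (hw.map φ.injective)
    rw [SimpleGraph.Walk.edges_map, List.map_map] at key
    rw [C.pathLength_eq C.len w hw, ← h1 i, ← h1 j]
    refine Eq.trans ?_ key.symm
    congr 1
    refine List.map_congr_left fun e he => ?_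
    exact (h2 e (w.edges_subset_edgeSet he)).symm

/-- The map `φ_n = q_n ∘ dist_n : M_{0,n,trop} → Q_n`. -/
noncomputable def phi (n : ℕ) : M0n n → Q n :=
  Quotient.lift (fun C : Curve n => q n (C.distVec C.len))
    fun _ _ h => congrArg (q n) (Curve.Iso.distVec_eq h)

/-- The projection of `ℝ^(n+1 choose 2)` to the coordinates not involving the last label. -/
def pr (n : ℕ) : (Pairs (n + 1) → ℝ) →ₗ[ℝ] (Pairs n → ℝ) :=
  LinearMap.funLeft ℝ ℝ fun p =>
    ⟨Sym2.map Fin.castSucc p.1, by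
      rw [Sym2.isDiag_map (Fin.castSucc_injective n)]; exact p.2⟩

lemma range_Phi_le (n : ℕ) :
    LinearMap.range (Phi (n + 1)) ≤ (LinearMap.range (Phi n)).comap (pr n) := by
  rintro _ ⟨a, rfl⟩
  refine ⟨fun i => a i.castSucc, ?_⟩
  funext ⟨p, hp⟩
  induction p using Sym2.ind with
  | _ i j => rfl

/-- The linear map `Q_{n+1} → Q_n` induced by the coordinate projection `pr`. -/
def prQ (n : ℕ) : Q (n + 1) →ₗ[ℝ] Q n :=
  Submodule.mapQ _ _ (pr n) (range_Phi_le n)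

/-! ### The fan structure of `M_{0,n,trop}` -/

/-- The cone in `Q_n` of a combinatorial type: its curves, where lengths may degenerate to `0`. -/
def CombType.cone (T : CombType n) : Set (Q n) :=
  {x | ∃ len : Sym2 T.V → ℝ, (∀ e ∈ T.G.edgeSet, 0 ≤ len e) ∧ x = q n (T.distVec len)}

/-- The set of the cones in `Q_n` of all combinatorial types of `n`-marked curves. -/
def m0nFan (n : ℕ) : Set (Set (Q n)) := Set.range fun T : CombType n => T.cone

/-- The tree with one bounded edge of length one, with the marked ends with labels in `I` on one
side of it and the remaining ones on the other side. -/
noncomputable def splitCurve (I : Finset (Fin n)) (h1 : 1 < I.card) (h2 : I.card + 1 < n) :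
    Curve n where
  V := Bool
  finite := inferInstance
  G := ⊤
  isTree := by
    rw [SimpleGraph.isTree_iff]
    exact ⟨SimpleGraph.connected_top, SimpleGraph.IsAcyclic.of_card_le_two (by simp)⟩
  leg i := decide (i ∈ I)
  stable v := by
    have hn : (⊤ : SimpleGraph Bool).neighborSet v = {!v} := by
      ext w; cases v <;> cases w <;> simp
    rw [valence, hn, Set.ncard_singleton]
    cases v
    · have : {i : Fin n | decide (i ∈ I) = false} = ((Iᶜ : Finset (Fin n)) : Set (Fin n)) := by
        ext; simp
      rw [this, Set.ncard_coe_finset, Finset.card_compl, Fintype.card_fin]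
      omega
    · have : {i : Fin n | decide (i ∈ I) = true} = (I : Set (Fin n)) := by
        ext; simp
      rw [this, Set.ncard_coe_finset]
      omega
  len _ := 1
  len_pos _ _ := one_pos

/-- The vector `v_I ∈ Q_n`. -/
noncomputable def vI (I : Finset (Fin n)) (h1 : 1 < I.card) (h2 : I.card + 1 < n) : Q n :=
  phi n (Quotient.mk _ (splitCurve I h1 h2))

/-- The lattice `Λ_n` in `Q_n` generated by the vectors `v_I`, where `1 < |I| < n - 1`. -/
def Lam (n : ℕ) : AddSubgroup (Q n) :=
  AddSubgroup.closure
    {x | ∃ (I : Finset (Fin n)) (h1 : 1 < I.card) (h2 : I.card + 1 < n), x = vI I h1 h2}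

/-! ### Forgetting the last marked end -/

/-- The graph obtained from `G` by straightening the vertex `v`: the vertex `v` is removed, and two
different neighbours of `v` are joined by an edge. -/
def straighten {V : Type} (G : SimpleGraph V) (v : V) : SimpleGraph {w : V // w ≠ v} where
  Adj a b := G.Adj a b ∨ (a ≠ b ∧ G.Adj a v ∧ G.Adj v b)
  symm := ⟨fun _ _ h => h.imp SimpleGraph.Adj.symm fun h => ⟨h.1.symm, h.2.2.symm, h.2.1.symm⟩⟩
  loopless := ⟨fun _ h => h.elim (fun h => G.loopless.irrefl _ h) fun h => h.1 rfl⟩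

/-- The lengths of the edges after straightening `v`: the lengths of edges that are joined at `v`
are added. -/
noncomputable def straightenLen {V : Type} (G : SimpleGraph V) (v : V) (len : Sym2 V → ℝ) :
    Sym2 {w : V // w ≠ v} → ℝ :=
  open Classical in
  Sym2.lift ⟨fun a b => if G.Adj a b then len s(↑a, ↑b) else len s(↑a, v) + len s(v, ↑b),
    fun a b => by
      beta_reduce
      rw [Sym2.eq_swap (a := (b : V)) (b := a), Sym2.eq_swap (a := (b : V)) (b := v),
        Sym2.eq_swap (a := (a : V)) (b := v), add_comm]
      classical exact if_congr (G.adj_comm a b) rfl rfl⟩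

/-- The new position of a point when `v` is removed: a marked end attached at `v` (together with
the bounded edge from `v` to its neighbour, if `v` has become a `2`-valent vertex adjacent to one
bounded and one unbounded edge) is now attached at this neighbour. -/
noncomputable def straightenVertex {V : Type} (G : SimpleGraph V) (v : V) (h : ∃ u, G.Adj v u)
    (w : V) : {w : V // w ≠ v} :=
  open Classical in
  if hw : w = v then ⟨h.choose, h.choose_spec.ne'⟩ else ⟨w, hw⟩

lemma straightenVertex_of_ne {V : Type} (G : SimpleGraph V) (v : V) (h : ∃ u, G.Adj v u)
    {w : V} (hw : w ≠ v) : straightenVertex G v h w = ⟨w, hw⟩ := by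
  simp [straightenVertex, hw]

lemma adj_straightenVertex_self {V : Type} (G : SimpleGraph V) (v : V) (h : ∃ u, G.Adj v u) :
    G.Adj v (straightenVertex G v h v) := by
  simpa [straightenVertex] using h.choose_spec

lemma straighten_step {V : Type} (G : SimpleGraph V) (v : V) (h : ∃ u, G.Adj v u) {x y : V}
    (hxy : G.Adj x y) : straightenVertex G v h x = straightenVertex G v h y ∨
      (straighten G v).Adj (straightenVertex G v h x) (straightenVertex G v h y) := by
  by_cases e : straightenVertex G v h x = straightenVertex G v h y
  · exact Or.inl e
  right
  have hu := adj_straightenVertex_self G v h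
  by_cases hx : x = v
  · subst hx
    have hy : y ≠ x := hxy.ne'
    refine Or.inr ⟨e, hu.symm, ?_⟩
    rw [straightenVertex_of_ne G x h hy]
    exact hxy
  · by_cases hy : y = v
    · subst hy
      refine Or.inr ⟨e, ?_, hu⟩
      rw [straightenVertex_of_ne G y h hx]
      exact hxy
    · left
      rw [straightenVertex_of_ne G v h hx, straightenVertex_of_ne G v h hy]
      exact hxy

lemma straighten_reachable {V : Type} (G : SimpleGraph V) (v : V) (h : ∃ u, G.Adj v u) {x y : V}
    (p : G.Walk x y) :
    (straighten G v).Reachable (straightenVertex G v h x) (straightenVertex G v h y) := by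
  induction p with
  | nil => exact SimpleGraph.Reachable.refl _
  | cons hxy _ ih =>
    rcases straighten_step G v h hxy with e | e
    · rw [e]; exact ih
    · exact e.reachable.trans ih

lemma straighten_isTree {V : Type} [Finite V] (G : SimpleGraph V) (hG : G.IsTree) (v : V)
    (h : ∃ u, G.Adj v u) (hv : (G.neighborSet v).ncard ≤ 2) : (straighten G v).IsTree := by
  classical
  have hu := adj_straightenVertex_self G v h
  have hconn : (straighten G v).Connected := by
    have : Nonempty {w : V // w ≠ v} := ⟨straightenVertex G v h v⟩
    refine ⟨fun a b => ?_⟩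
    obtain ⟨p⟩ := hG.connected.preconnected a b
    have := straighten_reachable G v h p
    rwa [straightenVertex_of_ne G v h a.2, straightenVertex_of_ne G v h b.2] at this
  rw [SimpleGraph.isTree_iff_connected_and_card]
  refine ⟨hconn, le_antisymm ?_ hconn.card_vert_le_card_edgeSet_add_one⟩
  have hc := (SimpleGraph.isTree_iff_connected_and_card.1 hG).2
  have hV : Nat.card {w : V // w ≠ v} + 1 = Nat.card V := by
    have := Set.ncard_add_ncard_compl ({v} : Set V)
    rw [Set.ncard_singleton] at this
    have h2 : Nat.card {w : V // w ≠ v} = ({v}ᶜ : Set V).ncard := rfl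
    omega
  set u := straightenVertex G v h v with hudef
  have hsub : (straighten G v).edgeSet ⊆
      Sym2.map (straightenVertex G v h) '' (G.edgeSet \ {s(v, ↑u)}) := by
    intro e he
    induction e using Sym2.ind with
    | _ a b =>
      rw [SimpleGraph.mem_edgeSet] at he
      rcases he with he | ⟨hab, hav, hvb⟩
      · refine ⟨s(↑a, ↑b), ⟨he, ?_⟩, ?_⟩
        · simp [a.2, b.2]
        · rw [Sym2.map_mk, straightenVertex_of_ne G v h a.2, straightenVertex_of_ne G v h b.2]
      · by_cases ha : a = u
        · subst ha
          refine ⟨s(v, ↑b), ⟨hvb, ?_⟩, ?_⟩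
          · simp only [Set.mem_singleton_iff, Sym2.congr_right]
            exact fun hh => hab (Subtype.ext hh.symm)
          · rw [Sym2.map_mk, straightenVertex_of_ne G v h b.2]
        · have hb : b = u := by
            by_contra hb
            have h3 : ({↑a, ↑b, ↑u} : Set V) ⊆ G.neighborSet v := by
              rintro x (rfl | rfl | rfl)
              exacts [hav.symm, hvb, hu]
            have h4 := Set.ncard_le_ncard h3
            rw [Set.ncard_eq_three.2 ⟨(a : V), b, u, fun hh => hab (Subtype.ext hh),
              fun hh => ha (Subtype.ext hh), fun hh => hb (Subtype.ext hh), rfl⟩] at h4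
            omega
          subst hb
          refine ⟨s(↑a, v), ⟨hav, ?_⟩, ?_⟩
          · rw [Set.mem_singleton_iff, Sym2.eq_swap, Sym2.congr_right]
            exact fun hh => hab (Subtype.ext hh)
          · rw [Sym2.map_mk, straightenVertex_of_ne G v h a.2]
  have h5 : (straighten G v).edgeSet.ncard ≤ G.edgeSet.ncard - 1 :=
    (Set.ncard_le_ncard hsub).trans ((Set.ncard_image_le (Set.toFinite _)).trans
      (Set.ncard_sdiff_singleton_of_mem (show s(v, ↑u) ∈ G.edgeSet from hu)).le)
  have h6 : 0 < G.edgeSet.ncard :=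
    (Set.ncard_pos (Set.toFinite _)).2 ⟨_, (show s(v, ↑u) ∈ G.edgeSet from hu)⟩
  have h7 : Nat.card G.edgeSet = G.edgeSet.ncard := rfl
  have h8 : Nat.card (straighten G v).edgeSet = (straighten G v).edgeSet.ncard := rfl
  omega

/-- In a tree two neighbours of a vertex are not adjacent. -/
lemma not_adj_of_adj_adj {V : Type} {G : SimpleGraph V} (hG : G.IsTree) {a v b : V}
    (ha : G.Adj a v) (hb : G.Adj v b) : ¬ G.Adj a b := by
  intro hab
  let p : G.Walk a b := SimpleGraph.Walk.cons ha (SimpleGraph.Walk.cons hb SimpleGraph.Walk.nil)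
  let p' : G.Walk a b := SimpleGraph.Walk.cons hab SimpleGraph.Walk.nil
  have hp : p.IsPath := by simp [p, ha.ne, hb.ne, hab.ne]
  have hp' : p'.IsPath := by simp [p', hab.ne]
  have := congrArg SimpleGraph.Walk.length ((hG.existsUnique_path a b).unique hp hp')
  simp [p, p'] at this

namespace CombType

/-- The vertex at which the last marked end is attached. -/
def lastVertex (T : CombType (n + 1)) : T.V := T.leg (Fin.last n)

/-- The remaining marked ends. -/
def initLeg (T : CombType (n + 1)) (i : Fin n) : T.V := T.leg i.castSucc

lemma ncard_leg_of_ne (T : CombType (n + 1)) {w : T.V} (hw : w ≠ T.lastVertex) :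
    {i | T.leg i = w}.ncard = {i | T.initLeg i = w}.ncard := by
  rw [← Set.ncard_image_of_injective _ (Fin.castSucc_injective n)]
  congr 1
  ext i
  refine Fin.lastCases ?_ (fun j => ?_) i
  · simp only [Set.mem_ofPred_eq, Set.mem_image]
    exact ⟨fun h => absurd h.symm hw, fun ⟨j, _, h⟩ => absurd h (Fin.castSucc_lt_last j).ne⟩
  · simp [initLeg]

lemma ncard_leg_last (T : CombType (n + 1)) :
    {i | T.leg i = T.lastVertex}.ncard = {i | T.initLeg i = T.lastVertex}.ncard + 1 := by
  rw [← Set.ncard_image_of_injective {i | T.initLeg i = T.lastVertex} (Fin.castSucc_injective n),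
    ← Set.ncard_insert_of_notMem (a := Fin.last n)]
  · congr 1
    ext i
    refine Fin.lastCases ?_ (fun j => ?_) i
    · simp [lastVertex]
    · simp [initLeg]
  · rintro ⟨j, _, h⟩
    exact (Fin.castSucc_lt_last j).ne h

lemma valence_initLeg_of_ne (T : CombType (n + 1)) {w : T.V} (hw : w ≠ T.lastVertex) :
    valence T.G T.initLeg w = valence T.G T.leg w := by
  rw [valence, valence, T.ncard_leg_of_ne hw]

lemma valence_lastVertex (T : CombType (n + 1)) :
    valence T.G T.leg T.lastVertex = valence T.G T.initLeg T.lastVertex + 1 := by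
  rw [valence, valence, T.ncard_leg_last, add_assoc]

/-- Removing the last marked end if this leaves no `2`-valent vertex. -/
def forgetKeep (T : CombType (n + 1)) (h : valence T.G T.leg T.lastVertex ≠ 3) :
    CombType n where
  V := T.V
  finite := T.finite
  G := T.G
  isTree := T.isTree
  leg := T.initLeg
  stable w := by
    by_cases hw : w = T.lastVertex
    · subst hw
      have := T.stable T.lastVertex
      have := T.valence_lastVertex
      omega
    · rw [T.valence_initLeg_of_ne hw]
      exact T.stable w

lemma exists_adj_lastVertex (hn : 3 ≤ n) (T : CombType (n + 1))
    (h : valence T.G T.leg T.lastVertex = 3) : ∃ u, T.G.Adj T.lastVertex u := by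
  by_contra! hu
  have hall : ∀ w, w = T.lastVertex := fun w => by
    by_contra hw
    obtain ⟨p⟩ := T.isTree.connected.preconnected T.lastVertex w
    cases p with
    | nil => exact hw rfl
    | cons h' _ => exact hu _ h'
  have : {i | T.leg i = T.lastVertex} = Set.univ := by
    ext i; simp [hall (T.leg i)]
  rw [valence, this, Set.ncard_univ, Nat.card_eq_fintype_card, Fintype.card_fin] at h
  omega

lemma ncard_neighborSet_lastVertex_le (T : CombType (n + 1))
    (h : valence T.G T.leg T.lastVertex = 3) : (T.G.neighborSet T.lastVertex).ncard ≤ 2 := by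
  rw [valence_lastVertex, valence] at h
  omega

lemma straighten_stable (hn : 3 ≤ n) (T : CombType (n + 1))
    (h : valence T.G T.leg T.lastVertex = 3) (w : {w : T.V // w ≠ T.lastVertex}) :
    3 ≤ valence (straighten T.G T.lastVertex) (fun i => straightenVertex T.G T.lastVertex
      (T.exists_adj_lastVertex hn h) (T.initLeg i)) w := by
  have := T.finite
  obtain ⟨w, hw⟩ := w
  have hu := T.exists_adj_lastVertex hn h
  have hst : 3 ≤ valence T.G T.initLeg w := by
    rw [T.valence_initLeg_of_ne hw]; exact T.stable w
  have hval : (T.G.neighborSet T.lastVertex).ncard + {i | T.initLeg i = T.lastVertex}.ncard = 2 := by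
    have := T.valence_lastVertex
    rw [h, valence] at this
    omega
  set N : Set T.V := Subtype.val '' ((straighten T.G T.lastVertex).neighborSet ⟨w, hw⟩) with hN
  have hNc : ((straighten T.G T.lastVertex).neighborSet ⟨w, hw⟩).ncard = N.ncard :=
    (Set.ncard_image_of_injective _ Subtype.val_injective).symm
  have hN1 : T.G.neighborSet w \ {T.lastVertex} ⊆ N := fun x hx => ⟨⟨x, hx.2⟩, Or.inl hx.1, rfl⟩
  set P : Set (Fin n) := {i | straightenVertex T.G T.lastVertex hu (T.initLeg i) = ⟨w, hw⟩} with hP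
  have hP1 : {i | T.initLeg i = w} ⊆ P := fun i hi => by
    have hi : T.initLeg i = w := hi
    change straightenVertex T.G T.lastVertex hu (T.initLeg i) = ⟨w, hw⟩
    rw [hi, straightenVertex_of_ne T.G T.lastVertex hu hw]
  change 3 ≤ ((straighten T.G T.lastVertex).neighborSet ⟨w, hw⟩).ncard + P.ncard
  rw [hNc]
  rw [valence] at hst
  have hPc := Set.ncard_le_ncard hP1
  by_cases hwv : T.G.Adj w T.lastVertex
  · have hNc1 := Set.ncard_le_ncard hN1
    rw [Set.ncard_sdiff_singleton_of_mem (show T.lastVertex ∈ T.G.neighborSet w from hwv)] at hNc1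
    by_cases hk : ∃ k, T.initLeg k = T.lastVertex
    · obtain ⟨k, hk⟩ := hk
      have h1 : 0 < {i | T.initLeg i = T.lastVertex}.ncard :=
        (Set.ncard_pos (Set.toFinite _)).2 ⟨k, hk⟩
      have h2 : (T.G.neighborSet T.lastVertex).ncard ≤ 1 := by omega
      have h3 : (straightenVertex T.G T.lastVertex hu T.lastVertex : T.V) = w :=
        (Set.ncard_le_one (Set.toFinite _)).1 h2 _ (adj_straightenVertex_self T.G T.lastVertex hu) _
          hwv.symm
      have hP2 : insert k {i | T.initLeg i = w} ⊆ P := by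
        rintro i (rfl | hi)
        · change straightenVertex T.G T.lastVertex hu (T.initLeg i) = ⟨w, hw⟩
          rw [hk]
          exact Subtype.ext h3
        · exact hP1 hi
      have := Set.ncard_le_ncard hP2
      have hkw : k ∉ {i | T.initLeg i = w} := fun hh =>
        hw ((show T.initLeg k = w from hh).symm.trans hk)
      rw [Set.ncard_insert_of_notMem hkw] at this
      omega
    · have h1 : {i | T.initLeg i = T.lastVertex} = ∅ := by
        ext i; simpa using fun hi => hk ⟨i, hi⟩
      rw [h1, Set.ncard_empty] at hval
      obtain ⟨b, hb, hbw⟩ := Set.exists_ne_of_one_lt_ncard (s := T.G.neighborSet T.lastVertex)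
        (by omega) w
      have hb : T.G.Adj T.lastVertex b := hb
      have hN2 : insert b (T.G.neighborSet w \ {T.lastVertex}) ⊆ N := by
        rintro x (rfl | hx)
        · exact ⟨⟨x, hb.ne'⟩, Or.inr ⟨fun hh => hbw (Subtype.ext_iff.1 hh).symm, hwv, hb⟩, rfl⟩
        · exact hN1 hx
      have := Set.ncard_le_ncard hN2
      rw [Set.ncard_insert_of_notMem (fun hh => not_adj_of_adj_adj T.isTree hwv hb hh.1),
        Set.ncard_sdiff_singleton_of_mem (show T.lastVertex ∈ T.G.neighborSet w from hwv)] at this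
      have : 0 < (T.G.neighborSet w).ncard :=
        (Set.ncard_pos (Set.toFinite _)).2 ⟨T.lastVertex, hwv⟩
      omega
  · have h1 : T.G.neighborSet w \ {T.lastVertex} = T.G.neighborSet w :=
      Set.sdiff_singleton_eq_self hwv
    rw [h1] at hN1
    have := Set.ncard_le_ncard hN1
    omega

/-- Removing the last marked end and straightening the `2`-valent vertex that this leaves. -/
noncomputable def forgetStraighten (hn : 3 ≤ n) (T : CombType (n + 1))
    (h : valence T.G T.leg T.lastVertex = 3) : CombType n where
  V := {w : T.V // w ≠ T.lastVertex}
  finite := haveI := T.finite; inferInstance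
  G := straighten T.G T.lastVertex
  isTree := haveI := T.finite
    straighten_isTree T.G T.isTree T.lastVertex (T.exists_adj_lastVertex hn h)
      (T.ncard_neighborSet_lastVertex_le h)
  leg i := straightenVertex T.G T.lastVertex (T.exists_adj_lastVertex hn h) (T.initLeg i)
  stable := T.straighten_stable hn h

end CombType

lemma straightenLen_pos {V : Type} (G : SimpleGraph V) (v : V) (len : Sym2 V → ℝ)
    (hl : ∀ e ∈ G.edgeSet, 0 < len e) :
    ∀ e ∈ (straighten G v).edgeSet, 0 < straightenLen G v len e := by
  intro e he
  induction e using Sym2.ind with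
  | _ a b =>
    rw [SimpleGraph.mem_edgeSet] at he
    simp only [straightenLen, Sym2.lift_mk]
    split_ifs with hab
    · exact hl _ hab
    · rcases he with he | ⟨-, h1, h2⟩
      · exact absurd he hab
      · exact add_pos (hl _ h1) (hl _ h2)

/-- The stabilization of the curve obtained by removing the last marked end. -/
noncomputable def Curve.forget (hn : 3 ≤ n) (C : Curve (n + 1)) : Curve n :=
  open Classical in
  if h : valence C.G C.leg C.lastVertex = 3 then
    { toCombType := C.forgetStraighten hn h
      len := straightenLen C.G C.lastVertex C.len
      len_pos := straightenLen_pos C.G C.lastVertex C.len C.len_pos }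
  else
    { toCombType := C.forgetKeep h
      len := C.len
      len_pos := C.len_pos }

lemma valence_iso {V W : Type} {m : ℕ} {G : SimpleGraph V} {H : SimpleGraph W} {l : Fin m → V}
    {l' : Fin m → W} (φ : G ≃g H) (h : ∀ i, φ (l i) = l' i) (v : V) :
    valence H l' (φ v) = valence G l v := by
  have h1 : H.neighborSet (φ v) = φ '' G.neighborSet v := by
    ext w
    obtain ⟨w, rfl⟩ := φ.surjective w
    simp [φ.map_adj_iff]
  have h2 : {i | l' i = φ v} = {i | l i = v} := by
    ext i; simp [← h]
  rw [valence, valence, h1, h2, Set.ncard_image_of_injective _ φ.injective]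

/-- Isomorphisms of graphs are compatible with straightening. -/
def straightenIso {V W : Type} {G : SimpleGraph V} {H : SimpleGraph W} (φ : G ≃g H) (v : V)
    (w : W) (h : φ v = w) : straighten G v ≃g straighten H w where
  toEquiv := φ.toEquiv.subtypeEquiv fun a => by
    rw [← h]; exact φ.injective.ne_iff.symm
  map_rel_iff' := by
    intro a b
    subst h
    change (H.Adj (φ a) (φ b) ∨ _ ≠ _ ∧ H.Adj (φ a) (φ v) ∧ H.Adj (φ v) (φ b)) ↔
      (G.Adj a b ∨ a ≠ b ∧ G.Adj a v ∧ G.Adj v b)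
    rw [φ.map_adj_iff, φ.map_adj_iff, φ.map_adj_iff, Equiv.injective _ |>.ne_iff]

lemma straightenLen_iso {V W : Type} {G : SimpleGraph V} {H : SimpleGraph W} (φ : G ≃g H) (v : V)
    (w : W) (h : φ v = w) (len : Sym2 V → ℝ) (len' : Sym2 W → ℝ)
    (hl : ∀ e ∈ G.edgeSet, len' (Sym2.map φ e) = len e) :
    ∀ e ∈ (straighten G v).edgeSet,
      straightenLen H w len' (Sym2.map (straightenIso φ v w h) e) = straightenLen G v len e := by
  subst h
  intro e he
  induction e using Sym2.ind with
  | _ a b =>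
    have ha : (straightenIso φ v _ rfl a : W) = φ a.1 := rfl
    have hb : (straightenIso φ v _ rfl b : W) = φ b.1 := rfl
    have he : G.Adj a.1 b.1 ∨ (a ≠ b ∧ G.Adj a.1 v ∧ G.Adj v b.1) := he
    simp only [straightenLen, Sym2.map_mk, Sym2.lift_mk]
    rw [ha, hb]
    by_cases hab : G.Adj a.1 b.1
    · rw [if_pos hab, if_pos (φ.map_adj_iff.2 hab)]
      exact hl s(a.1, b.1) hab
    · rw [if_neg hab, if_neg (fun hh => hab (φ.map_adj_iff.1 hh))]
      rcases he with he | ⟨-, he1, he2⟩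
      · exact absurd he hab
      · rw [← hl s(a.1, v) he1, ← hl s(v, b.1) he2]
        rfl

lemma Curve.Iso.forget (hn : 3 ≤ n) {C D : Curve (n + 1)} (h : C.Iso D) :
    (C.forget hn).Iso (D.forget hn) := by
  obtain ⟨φ, h1, h2⟩ := h
  have hlast : φ C.lastVertex = D.lastVertex := h1 _
  have hval : valence D.G D.leg D.lastVertex = valence C.G C.leg C.lastVertex := by
    rw [← hlast]; exact valence_iso φ h1 _
  by_cases h3 : valence C.G C.leg C.lastVertex = 3
  · have h3' := hval.trans h3
    rw [Curve.forget, Curve.forget, dif_pos h3, dif_pos h3']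
    refine ⟨straightenIso φ _ _ hlast, fun i => ?_, fun e he => ?_⟩
    · have hi : φ (C.initLeg i) = D.initLeg i := h1 _
      apply Subtype.ext
      change φ (straightenVertex C.G C.lastVertex (C.exists_adj_lastVertex hn h3) (C.initLeg i)) =
        (straightenVertex D.G D.lastVertex (D.exists_adj_lastVertex hn h3') (D.initLeg i) : D.V)
      by_cases hc : C.initLeg i = C.lastVertex
      · have hd : D.initLeg i = D.lastVertex := by rw [← hi, hc, hlast]
        rw [hc, hd]
        have := D.finite
        have hd1 : (D.G.neighborSet D.lastVertex).ncard ≤ 1 := by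
          have h4 := D.valence_lastVertex
          rw [h3', valence] at h4
          have : 0 < {j | D.initLeg j = D.lastVertex}.ncard :=
            (Set.ncard_pos (Set.toFinite _)).2 ⟨i, hd⟩
          omega
        refine (Set.ncard_le_one (Set.toFinite _)).1 hd1 _ ?_ _ (adj_straightenVertex_self _ _ _)
        rw [SimpleGraph.mem_neighborSet, ← hlast, φ.map_adj_iff]
        exact adj_straightenVertex_self _ _ _
      · have hd : D.initLeg i ≠ D.lastVertex := by
          rw [← hi, ← hlast]; exact fun hh => hc (φ.injective hh)
        rw [straightenVertex_of_ne _ _ _ hc, straightenVertex_of_ne _ _ _ hd]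
        exact hi
    · exact straightenLen_iso φ _ _ hlast C.len D.len h2 e he
  · have h3' : valence D.G D.leg D.lastVertex ≠ 3 := by rw [hval]; exact h3
    rw [Curve.forget, Curve.forget, dif_neg h3, dif_neg h3']
    exact ⟨φ, fun i => h1 _, h2⟩

/-- The forgetful map `ft : M_{0,n+1,trop} → M_{0,n,trop}` for `n + 1 ≥ 4`. -/
noncomputable def ft (hn : 3 ≤ n) : M0n (n + 1) → M0n n :=
  Quotient.map (Curve.forget hn) fun _ _ h => Curve.Iso.forget hn h

end TropM0n

/-! A bounded edge of a marked tree splits the labels into two parts, and the distance vector is the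
sum over the edges of the length times the 0/1 vector `cutVec` of the pairs separated by the split.
Fix a label `r` and record each split by the part `A` avoiding `r`. Stable trees then correspond to
laminar families: the parts are pairwise nested or disjoint, and each part and its complement have
at least two elements. So the cones of combinatorial types are exactly the cones `conic 𝓑 splitVec`
over laminar families `𝓑` (`CombType.exists_realizes`, `IsLaminar.exists_combType`), and the fan
axioms become statements about such families.

The tool on the linear side is the Gromov product `(i|j)_r = (d_ir + d_jr - d_ij) / 2`. On `im Φ` it
does not depend on `i, j`, so differences of two products with base point `r` descend to `Q_n`. On
`cutVec A` with `r ∉ A` it is the indicator of `i, j ∈ A`, so these differences are integral on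
`Λ_n`. They give a dual basis to the splits of two-element sets, hence `Λ_n` is a lattice
(`isLattice_Lam`). They give integral forms dual to the generators of a laminar cone, hence
equations for it and its faces (`IsLaminar.exists_dual`, `isFace_conic`). Their signs detect the
members of a laminar family, so two cones meet in the cone over the common splits
(`IsLaminar.conic_inter`).

For the forgetful map, removing `x_n` changes the other distances only if a bounded edge is absorbed
into another end `x_i`. All distances from `x_i` then drop by the same amount, which is an element
of `im Φ` (`CombType.pr_distVec_forgetStraighten`). Integrality of the projection holds because
restricting a split to fewer labels gives a split, or the zero vector if a part becomes too small.
-/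

namespace TropM0n

/-! ### Simplicial cones -/

section Simplicial

variable {V α : Type} [AddCommGroup V] [Module ℝ V]

/-- The cone spanned by the vectors `v A`, `A ∈ s`. -/
def conic (s : Finset α) (v : α → V) : Set V :=
  {x | ∃ a : α → ℝ, (∀ A ∈ s, 0 ≤ a A) ∧ x = ∑ A ∈ s, a A • v A}

lemma mem_conic_of_mem {s : Finset α} (v : α → V) {A : α} (hA : A ∈ s) : v A ∈ conic s v := by
  classical
  refine ⟨fun B => if B = A then 1 else 0, fun B _ => by positivity, ?_⟩
  simp [ite_smul, hA]

/-- With integral dual forms `g A`, the cone is cut out by the equations of the span of the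
generators and by `g A ≥ 0`. Turning `g A ≥ 0` into an equality for `A ∈ s \ t` leaves the cone over
`t`. -/
lemma isFace_conic {L : AddSubgroup V} (hL : IsLattice L) [DecidableEq α] {s t : Finset α}
    (hts : t ⊆ s) (v : α → V) (g : α → V →ₗ[ℝ] ℝ) (hv : ∀ A ∈ s, v A ∈ L)
    (hg : ∀ A ∈ s, g A ∈ dualLattice L)
    (hgv : ∀ A ∈ s, ∀ B ∈ s, g A (v B) = if A = B then 1 else 0) :
    IsFace L (conic t v) (conic s v) := by
  obtain ⟨ι, hι, b, rfl⟩ := hL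
  -- `P` is a projection whose kernel is the span of the generators. It preserves `L` because `v A ∈
  -- L` and `g A` is integral, so its coordinates in a lattice basis are integral equations for that
  -- span.
  set P : V →ₗ[ℝ] V := LinearMap.id - ∑ A ∈ s, (g A).smulRight (v A) with hP
  have hPx : ∀ x, P x = x - ∑ A ∈ s, g A x • v A := fun x => by simp [hP]
  have hga : ∀ a : α → ℝ, ∀ A ∈ s, g A (∑ B ∈ s, a B • v B) = a A := by
    intro a A hA
    rw [map_sum, Finset.sum_congr rfl fun B hB => by rw [map_smul, hgv A hA B hB]]
    simp [hA]
  have hPa : ∀ a : α → ℝ, P (∑ B ∈ s, a B • v B) = 0 := by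
    intro a
    rw [hPx, sub_eq_zero]
    exact Finset.sum_congr rfl fun A hA => by rw [hga a A hA]
  have hcoord : ∀ i, b.coord i ∈ dualLattice (AddSubgroup.closure (Set.range b)) := by
    intro i x hx
    induction hx using AddSubgroup.closure_induction with
    | mem x hx =>
      obtain ⟨j, rfl⟩ := hx
      classical
      exact ⟨if j = i then 1 else 0, by simp [Module.Basis.coord_apply, Finsupp.single_apply]⟩
    | zero => exact ⟨0, by simp⟩
    | add x y _ _ hx hy =>
      obtain ⟨k, hk⟩ := hx; obtain ⟨l, hl⟩ := hy
      exact ⟨k + l, by rw [map_add, hk, hl]; push_cast; rfl⟩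
    | neg x _ hx =>
      obtain ⟨k, hk⟩ := hx
      exact ⟨-k, by rw [map_neg, hk]; push_cast; rfl⟩
  have hPL : ∀ x ∈ AddSubgroup.closure (Set.range b), P x ∈ AddSubgroup.closure (Set.range b) := by
    intro x hx
    rw [hPx]
    refine AddSubgroup.sub_mem _ hx (AddSubgroup.sum_mem _ fun A hA => ?_)
    obtain ⟨k, hk⟩ := hg A hA x hx
    rw [hk, Int.cast_smul_eq_zsmul]
    exact AddSubgroup.zsmul_mem _ (hv A hA) k
  have hP0 : ∀ x, (∀ f ∈ Set.range fun i => b.coord i ∘ₗ P, f x = 0) ↔ P x = 0 := by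
    intro x
    refine ⟨fun h => b.ext_elem fun i => ?_, ?_⟩
    · simpa using h _ ⟨i, rfl⟩
    · rintro h _ ⟨i, rfl⟩
      simp [h]
  have hrep : ∀ x, P x = 0 → x = ∑ A ∈ s, g A x • v A := fun x h =>
    sub_eq_zero.1 ((hPx x).symm.trans h)
  refine ⟨Set.range fun i => b.coord i ∘ₗ P, g '' s, g '' ((s \ t : Finset α) : Set α),
    Set.finite_range _, s.finite_toSet.image g, ?_, ?_, ?_, ?_, ?_⟩
  · rintro _ ⟨i, rfl⟩ x hx
    exact hcoord i _ (hPL x hx)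
  · rintro _ ⟨A, hA, rfl⟩
    exact hg A hA
  · exact Set.image_mono (by simp)
  · ext x
    constructor
    · rintro ⟨a, ha, rfl⟩
      refine ⟨(hP0 _).2 (hPa a), ?_⟩
      rintro _ ⟨A, hA, rfl⟩
      rw [hga a A hA]
      exact ha A hA
    · rintro ⟨h1, h2⟩
      exact ⟨fun A => g A x, fun A hA => h2 _ ⟨A, hA, rfl⟩, hrep x ((hP0 x).1 h1)⟩
  · ext x
    constructor
    · rintro ⟨a, ha, rfl⟩
      have key : ∑ A ∈ t, a A • v A = ∑ A ∈ s, (if A ∈ t then a A else 0) • v A := by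
        rw [← Finset.sum_subset hts (fun A _ hA => by simp [hA])]
        exact Finset.sum_congr rfl fun A hA => by simp [hA]
      rw [key]
      refine ⟨?_, ?_⟩
      · rintro f (hf | ⟨A, hA, rfl⟩)
        · exact (hP0 _).2 (hPa _) f hf
        · have hA : A ∈ s ∧ A ∉ t := by simpa using hA
          rw [hga _ A hA.1, if_neg hA.2]
      · rintro _ ⟨⟨A, hA, rfl⟩, -⟩
        rw [hga _ A hA]
        split_ifs with h
        exacts [ha A h, le_rfl]
    · rintro ⟨h1, h2⟩
      have hx := hrep x ((hP0 x).1 fun f hf => h1 f (Or.inl hf))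
      have h0 : ∀ A ∈ s, A ∉ t → g A x = 0 := fun A hA hAt =>
        h1 _ (Or.inr ⟨A, by simp [hA, hAt], rfl⟩)
      refine ⟨fun A => g A x, fun A hA => ?_, ?_⟩
      -- This makes injectivity of `g` unnecessary: if `g A` equals one of the forms set to zero, it
      -- is nonnegative at `x` anyway.
      · by_cases h : g A ∈ g '' ((s \ t : Finset α) : Set α)
        · exact (h1 _ (Or.inr h)).ge
        · exact h2 _ ⟨⟨A, hts hA, rfl⟩, h⟩
      · rw [Finset.sum_subset hts fun A hA hAt => by
          change g A x • v A = 0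
          rw [h0 A hA hAt, zero_smul]]
        exact hx

/-- The forms in `J` are nonnegative on all generators. If such a form vanishes on a nonnegative
combination, every generator on which it is positive has coefficient zero. So the face is spanned by
the generators that `J` annihilates, whatever description of the cone is used. -/
lemma exists_conic_of_isFace {L : AddSubgroup V} {s : Finset α} {v : α → V} {τ : Set V}
    (h : IsFace L τ (conic s v)) : ∃ t ⊆ s, τ = conic t v := by
  classical
  obtain ⟨F, G, J, -, -, -, -, hJ, hσ, rfl⟩ := h
  have hset : solutionSet (F ∪ J) (G \ J) = {x | x ∈ conic s v ∧ ∀ f ∈ J, f x = 0} := by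
    rw [hσ]
    ext x
    constructor
    · rintro ⟨h1, h2⟩
      refine ⟨⟨fun f hf => h1 f (Or.inl hf), fun f hf => ?_⟩, fun f hf => h1 f (Or.inr hf)⟩
      by_cases hfJ : f ∈ J
      · exact (h1 f (Or.inr hfJ)).ge
      · exact h2 f ⟨hf, hfJ⟩
    · rintro ⟨⟨h1, h2⟩, h3⟩
      exact ⟨fun f hf => hf.elim (h1 f) (h3 f), fun f hf => h2 f hf.1⟩
  have hpos : ∀ f ∈ J, ∀ A ∈ s, 0 ≤ f (v A) := by
    intro f hf A hA
    have := mem_conic_of_mem v hA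
    rw [hσ] at this
    exact this.2 f (hJ hf)
  refine ⟨s.filter fun A => ∀ f ∈ J, f (v A) = 0, Finset.filter_subset _ _, ?_⟩
  rw [hset]
  ext x
  constructor
  · rintro ⟨⟨a, ha, rfl⟩, h⟩
    refine ⟨a, fun A hA => ha A (Finset.mem_filter.1 hA).1, ?_⟩
    refine (Finset.sum_subset (Finset.filter_subset _ _) fun A hA hAt => ?_).symm
    have : ∃ f ∈ J, f (v A) ≠ 0 := by
      by_contra! hh
      exact hAt (Finset.mem_filter.2 ⟨hA, hh⟩)
    obtain ⟨f, hf, hne⟩ := this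
    have h0 := h f hf
    simp only [map_sum, map_smul, smul_eq_mul] at h0
    rw [Finset.sum_eq_zero_iff_of_nonneg fun B hB => mul_nonneg (ha B hB) (hpos f hf B hB)] at h0
    rcases mul_eq_zero.1 (h0 A hA) with h1 | h1
    · rw [h1, zero_smul]
    · exact absurd h1 hne
  · rintro ⟨a, ha, rfl⟩
    refine ⟨⟨fun A => if ∀ f ∈ J, f (v A) = 0 then a A else 0, fun A hA => ?_, ?_⟩, ?_⟩
    · by_cases hh : ∀ f ∈ J, f (v A) = 0
      · simp only [if_pos hh]
        exact ha A (Finset.mem_filter.2 ⟨hA, hh⟩)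
      · simp only [if_neg hh, le_rfl]
    · rw [Finset.sum_filter]
      simp only [ite_smul, zero_smul]
    · intro f hf
      rw [map_sum]
      refine Finset.sum_eq_zero fun A hA => ?_
      rw [map_smul, (Finset.mem_filter.1 hA).2 f hf, smul_zero]

/-- Biorthogonality and separation give `x = ∑ f i x • v i` for every `x`; for `x ∈ L` the
coefficients are integers. -/
lemma isLattice_of_dual {L : AddSubgroup V} {ι : Type} [Fintype ι] [DecidableEq ι] (v : ι → V)
    (f : ι → V →ₗ[ℝ] ℝ) (hdual : ∀ i j, f i (v j) = if i = j then 1 else 0)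
    (hsep : ∀ x, (∀ i, f i x = 0) → x = 0) (hv : ∀ i, v i ∈ L) (hf : ∀ i, f i ∈ dualLattice L) :
    IsLattice L := by
  have hsum : ∀ x, x = ∑ i, f i x • v i := by
    intro x
    rw [← sub_eq_zero]
    refine hsep _ fun i => ?_
    simp [hdual]
  have hli : LinearIndependent ℝ v := by
    rw [Fintype.linearIndependent_iff]
    intro g hg i
    have := congrArg (f i) hg
    simpa [hdual] using this
  have hsp : ⊤ ≤ Submodule.span ℝ (Set.range v) := fun x _ => by
    rw [hsum x]
    exact Submodule.sum_mem _ fun p _ => Submodule.smul_mem _ _ (Submodule.subset_span ⟨p, rfl⟩)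
  refine ⟨ι, inferInstance, Module.Basis.mk hli hsp, le_antisymm ?_ ?_⟩
  · intro x hx
    rw [Module.Basis.coe_mk, hsum x]
    refine AddSubgroup.sum_mem _ fun i _ => ?_
    obtain ⟨k, hk⟩ := hf i x hx
    rw [hk, Int.cast_smul_eq_zsmul]
    exact AddSubgroup.zsmul_mem _ (AddSubgroup.subset_closure (Set.mem_range_self i)) k
  · rw [AddSubgroup.closure_le, Module.Basis.coe_mk]
    rintro _ ⟨i, rfl⟩
    exact hv i

lemma IsFace.isCone {L : AddSubgroup V} {τ σ : Set V} (h : IsFace L τ σ) : IsCone L σ := by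
  obtain ⟨F, G, -, h1, h2, h3, h4, -, h5, -⟩ := h
  exact ⟨F, G, h1, h2, h3, h4, h5⟩

end Simplicial

/-! ### Split vectors -/

variable {n : ℕ}

/-- The vector in `ℝ^(n choose 2)` of the pairs that are separated by `A`. -/
noncomputable def cutVec (A : Finset (Fin n)) : Pairs n → ℝ := fun p =>
  Sym2.lift ⟨fun i j => if (i ∈ A ↔ j ∈ A) then 0 else 1, fun i j => by
    simp only [iff_comm]⟩ p.1

/-- The class of `cutVec A` in `Q_n`. -/
noncomputable def splitVec (A : Finset (Fin n)) : Q n := q n (cutVec A)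

lemma cutVec_mk (A : Finset (Fin n)) {i j : Fin n} (h : ¬ (s(i, j)).IsDiag) :
    cutVec A ⟨s(i, j), h⟩ = if (i ∈ A ↔ j ∈ A) then 0 else 1 := rfl

lemma cutVec_compl (A : Finset (Fin n)) : cutVec Aᶜ = cutVec A := by
  funext ⟨p, hp⟩
  induction p using Sym2.ind with
  | _ i j => simp only [cutVec_mk, Finset.mem_compl, not_iff_not]

lemma splitVec_compl (A : Finset (Fin n)) : splitVec Aᶜ = splitVec A := by
  rw [splitVec, cutVec_compl, splitVec]

lemma vI_eq (I : Finset (Fin n)) (h1 : 1 < I.card) (h2 : I.card + 1 < n) :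
    vI I h1 h2 = splitVec I := by
  change q n ((splitCurve I h1 h2).distVec (splitCurve I h1 h2).len) = q n (cutVec I)
  congr 1
  funext ⟨p, hp⟩
  induction p using Sym2.ind with
  | _ i j =>
    set C := splitCurve I h1 h2
    change C.pathLength C.len (C.leg i) (C.leg j) = _
    rw [cutVec_mk]
    split_ifs with h
    · have : C.leg i = C.leg j := by
        change decide (i ∈ I) = decide (j ∈ I)
        simp [h]
      rw [this, C.pathLength_eq _ SimpleGraph.Walk.nil SimpleGraph.Walk.IsPath.nil]
      simp
    · have hne : C.leg i ≠ C.leg j := by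
        change decide (i ∈ I) ≠ decide (j ∈ I)
        simpa using h
      have hadj : C.G.Adj (C.leg i) (C.leg j) := hne
      rw [C.pathLength_eq _ (SimpleGraph.Walk.cons hadj SimpleGraph.Walk.nil) (by simp [hne])]
      rw [SimpleGraph.Walk.edges_cons, SimpleGraph.Walk.edges_nil, List.map_singleton,
        List.sum_singleton]
      rfl

/-- The size restrictions on `I` in the definition of `Λ_n` are harmless: for a set `B` with at most
one element, `cutVec B` is `Φ` of its indicator, and a set missing at most one label is replaced by
its complement. -/
lemma splitVec_mem_Lam (A : Finset (Fin n)) : splitVec A ∈ Lam n := by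
  have small : ∀ B : Finset (Fin n), B.card ≤ 1 → splitVec B = 0 := by
    intro B hB
    refine (Submodule.Quotient.mk_eq_zero _).2 ⟨fun i => if i ∈ B then 1 else 0, ?_⟩
    funext ⟨p, hp⟩
    induction p using Sym2.ind with
    | _ i j =>
      rw [cutVec_mk]
      change (if i ∈ B then (1 : ℝ) else 0) + (if j ∈ B then 1 else 0) = _
      have : ¬ (i ∈ B ∧ j ∈ B) := fun h =>
        hp (Finset.card_le_one.1 hB i h.1 j h.2)
      by_cases hi : i ∈ B <;> by_cases hj : j ∈ B <;> simp_all
  by_cases h1 : 1 < A.card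
  · by_cases h2 : A.card + 1 < n
    · exact AddSubgroup.subset_closure ⟨A, h1, h2, (vI_eq A h1 h2).symm⟩
    · rw [← splitVec_compl, small _ (by rw [Finset.card_compl, Fintype.card_fin]; omega)]
      exact zero_mem _
  · rw [small A (by omega)]
    exact zero_mem _

lemma Lam_induction {p : Q n → Prop} (hs : ∀ A, p (splitVec A)) (h0 : p 0)
    (hadd : ∀ x y, p x → p y → p (x + y)) (hneg : ∀ x, p x → p (-x)) {x : Q n} (hx : x ∈ Lam n) :
    p x := by
  induction hx using AddSubgroup.closure_induction with
  | mem x hx =>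
    obtain ⟨I, h1, h2, rfl⟩ := hx
    rw [vI_eq]
    exact hs I
  | zero => exact h0
  | add x y _ _ hx hy => exact hadd x y hx hy
  | neg x _ hx => exact hneg x hx

/-! ### Gromov products -/

/-- The coordinate of a vector in `ℝ^(n choose 2)` at `{i, j}`, or `0` if `i = j`. -/
noncomputable def coord (i j : Fin n) : (Pairs n → ℝ) →ₗ[ℝ] ℝ :=
  if h : i = j then 0 else LinearMap.proj ⟨s(i, j), h⟩

lemma coord_apply {i j : Fin n} (h : i ≠ j) (x : Pairs n → ℝ) : coord i j x = x ⟨s(i, j), h⟩ := by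
  rw [coord, dif_neg h]; rfl

lemma coord_Phi {i j : Fin n} (h : i ≠ j) (a : Fin n → ℝ) : coord i j (Phi n a) = a i + a j := by
  rw [coord_apply h]; rfl

lemma coord_cutVec {i j : Fin n} (h : i ≠ j) (A : Finset (Fin n)) :
    coord i j (cutVec A) = if (i ∈ A ↔ j ∈ A) then 0 else 1 := by
  rw [coord_apply h]; rfl

lemma coord_comm (i j : Fin n) : coord i j = coord j i := by
  by_cases h : i = j
  · rw [h]
  · refine LinearMap.ext fun x => ?_
    rw [coord_apply h, coord_apply (Ne.symm h)]
    congr 2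
    exact Sym2.eq_swap

/-- Pairs of different labels other than `r`. -/
abbrev RPair (r : Fin n) : Type := {p : Fin n × Fin n // p.1 ≠ p.2 ∧ p.1 ≠ r ∧ p.2 ≠ r}

/-- The Gromov product of the labels in `p` with base point `r`. -/
noncomputable def gromov (r : Fin n) (p : RPair r) : (Pairs n → ℝ) →ₗ[ℝ] ℝ :=
  (1 / 2 : ℝ) • (coord p.1.1 r + coord p.1.2 r - coord p.1.1 p.1.2)

lemma gromov_apply {r : Fin n} (p : RPair r) (x : Pairs n → ℝ) :
    gromov r p x = (1 / 2) * (coord p.1.1 r x + coord p.1.2 r x - coord p.1.1 p.1.2 x) := rfl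

lemma gromov_Phi {r : Fin n} (p : RPair r) (a : Fin n → ℝ) : gromov r p (Phi n a) = a r := by
  rw [gromov_apply, coord_Phi p.2.1, coord_Phi p.2.2.1, coord_Phi p.2.2.2]
  ring

lemma gromov_cutVec {r : Fin n} (p : RPair r) {A : Finset (Fin n)} (hr : r ∉ A) :
    gromov r p (cutVec A) = if p.1.1 ∈ A ∧ p.1.2 ∈ A then 1 else 0 := by
  rw [gromov_apply, coord_cutVec p.2.1, coord_cutVec p.2.2.1, coord_cutVec p.2.2.2]
  by_cases h1 : p.1.1 ∈ A <;> by_cases h2 : p.1.2 ∈ A <;> (simp [h1, h2, hr]; try norm_num)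

/-- Converse of `gromov_Phi`. The preimage is forced by `a r = c` and the coordinates at `{i, r}`;
the remaining coordinates then agree because every Gromov product equals `c`. -/
lemma mem_range_Phi {r : Fin n} {x : Pairs n → ℝ} {c : ℝ} (h : ∀ p : RPair r, gromov r p x = c) :
    x ∈ LinearMap.range (Phi n) := by
  refine ⟨fun i => if i = r then c else coord i r x - c, ?_⟩
  funext ⟨p, hp⟩
  induction p using Sym2.ind with
  | _ i j =>
    have hij : i ≠ j := hp
    rw [← coord_apply hij (Phi n _), ← coord_apply hij x, coord_Phi hij]
    by_cases hi : i = r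
    · subst hi
      rw [if_pos rfl, if_neg hij.symm, coord_comm i j]
      ring
    · by_cases hj : j = r
      · subst hj
        rw [if_pos rfl, if_neg hij]
        ring
      · rw [if_neg hi, if_neg hj]
        have := h ⟨(i, j), hij, hi, hj⟩
        rw [gromov_apply] at this
        linarith

/-- The difference of two Gromov products with the same base point, as a linear form on `Q_n`. -/
noncomputable def gromovDiff (r : Fin n) (p p' : RPair r) : Q n →ₗ[ℝ] ℝ :=
  Submodule.liftQ _ (gromov r p - gromov r p') (by
    rintro _ ⟨a, rfl⟩
    simp [gromov_Phi])

lemma gromovDiff_q {r : Fin n} (p p' : RPair r) (x : Pairs n → ℝ) :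
    gromovDiff r p p' (q n x) = gromov r p x - gromov r p' x := rfl

lemma gromovDiff_splitVec {r : Fin n} (p p' : RPair r) {A : Finset (Fin n)} (hr : r ∉ A) :
    gromovDiff r p p' (splitVec A) = (if p.1.1 ∈ A ∧ p.1.2 ∈ A then 1 else 0) -
      if p'.1.1 ∈ A ∧ p'.1.2 ∈ A then 1 else 0 := by
  rw [splitVec, gromovDiff_q, gromov_cutVec p hr, gromov_cutVec p' hr]

lemma gromovDiff_mem_dualLattice {r : Fin n} (p p' : RPair r) :
    gromovDiff r p p' ∈ dualLattice (Lam n) := by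
  intro x hx
  refine Lam_induction (p := fun x => ∃ k : ℤ, gromovDiff r p p' x = k) ?_ ⟨0, by simp⟩ ?_ ?_ hx
  · have : ∀ A : Finset (Fin n), r ∉ A → ∃ k : ℤ, gromovDiff r p p' (splitVec A) = k := fun A hr =>
      ⟨(if p.1.1 ∈ A ∧ p.1.2 ∈ A then 1 else 0) - if p'.1.1 ∈ A ∧ p'.1.2 ∈ A then 1 else 0, by
        rw [gromovDiff_splitVec p p' hr]; push_cast; rfl⟩
    intro A
    -- A split does not change under complement, so the part avoiding `r` may be used.
    by_cases hr : r ∈ A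
    · rw [← splitVec_compl]
      exact this _ (by simpa using hr)
    · exact this A hr
  · rintro x y ⟨k, hk⟩ ⟨l, hl⟩
    exact ⟨k + l, by rw [map_add, hk, hl]; push_cast; rfl⟩
  · rintro x ⟨k, hk⟩
    exact ⟨-k, by rw [map_neg, hk]; push_cast; rfl⟩

/-- The basis consists of the splits of two-element sets avoiding `r`, with one set `p0` left out.
The Gromov product of a pair is 1 on the split of that pair and 0 on the others, so subtracting the
product of `p0` yields the dual basis. If all differences vanish, the Gromov products are constant
and the vector lies in `im Φ`. -/
lemma isLattice_Lam (hn : 3 ≤ n) : IsLattice (Lam n) := by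
  classical
  let r : Fin n := ⟨0, by omega⟩
  let p0 : RPair r := ⟨(⟨1, by omega⟩, ⟨2, by omega⟩), by simp [r]⟩
  let ι : Type := {p : RPair r // p.1.1 < p.1.2 ∧ p ≠ p0}
  let v : ι → Q n := fun p => splitVec {p.1.1.1, p.1.1.2}
  have hr : ∀ p : RPair r, r ∉ ({p.1.1, p.1.2} : Finset (Fin n)) := fun p => by
    simpa using ⟨p.2.2.1.symm, p.2.2.2.symm⟩
  have key : ∀ p p' : RPair r, p.1.1 < p.1.2 → p'.1.1 < p'.1.2 →
      ((p.1.1 ∈ ({p'.1.1, p'.1.2} : Finset (Fin n)) ∧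
        p.1.2 ∈ ({p'.1.1, p'.1.2} : Finset (Fin n))) ↔ p = p') := by
    rintro ⟨⟨a, b⟩, h⟩ ⟨⟨c, d⟩, h'⟩ h1 h2
    simp only [Finset.mem_insert, Finset.mem_singleton, Subtype.mk.injEq, Prod.mk.injEq] at *
    constructor
    · rintro ⟨rfl | rfl, rfl | rfl⟩
      · exact absurd h1 (lt_irrefl _)
      · exact ⟨rfl, rfl⟩
      · exact absurd h1 (lt_asymm h2)
      · exact absurd h1 (lt_irrefl _)
    · rintro ⟨rfl, rfl⟩
      simp
  have hp0 : p0.1.1 < p0.1.2 := by simp [p0]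
  have hdual : ∀ p p' : ι, gromovDiff r p.1 p0 (v p') = if p = p' then 1 else 0 := by
    intro p p'
    rw [gromovDiff_splitVec _ _ (hr p'.1)]
    rw [if_congr (key _ _ p.2.1 p'.2.1) rfl rfl, if_congr (key _ _ hp0 p'.2.1) rfl rfl,
      if_neg (Ne.symm p'.2.2), sub_zero]
    exact if_congr Subtype.ext_iff.symm rfl rfl
  refine isLattice_of_dual v (fun p => gromovDiff r p.1 p0) hdual (fun z hz => ?_)
    (fun p => splitVec_mem_Lam _) fun p => gromovDiff_mem_dualLattice p.1 p0
  obtain ⟨y, rfl⟩ := Submodule.Quotient.mk_surjective _ z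
  refine (Submodule.Quotient.mk_eq_zero _).2 (mem_range_Phi (r := r) (c := gromov r p0 y) ?_)
  have hlt : ∀ p : RPair r, p.1.1 < p.1.2 → gromov r p y = gromov r p0 y := by
    intro p hp
    by_cases h : p = p0
    · rw [h]
    · exact sub_eq_zero.1 (hz (⟨p, hp, h⟩ : ι))
  intro p
  rcases lt_or_gt_of_ne p.2.1 with h | h
  · exact hlt p h
  · rw [← hlt ⟨(p.1.2, p.1.1), p.2.1.symm, p.2.2.2, p.2.2.1⟩ h, gromov_apply, gromov_apply,
      coord_comm p.1.1 p.1.2]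
    ring

/-! ### The coordinate projection on splits and lattices -/

lemma prQ_splitVec (A : Finset (Fin (n + 1))) :
    prQ n (splitVec A) = splitVec (Finset.univ.filter fun i : Fin n => i.castSucc ∈ A) := by
  change q n (pr n (cutVec A)) = q n _
  congr 1
  funext ⟨p, hp⟩
  induction p using Sym2.ind with
  | _ i j =>
    rw [cutVec_mk]
    simp only [Finset.mem_filter, Finset.mem_univ, true_and]
    rfl

lemma prQ_mem_Lam {x : Q (n + 1)} (hx : x ∈ Lam (n + 1)) : prQ n x ∈ Lam n := by
  refine Lam_induction (p := fun x => prQ n x ∈ Lam n) (fun A => ?_) ?_ ?_ ?_ hx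
  · rw [prQ_splitVec]
    exact splitVec_mem_Lam _
  · simp
  · intro x y hx hy
    rw [map_add]
    exact add_mem hx hy
  · intro x hx
    rw [map_neg]
    exact neg_mem hx

/-! ### Laminar families of splits -/

/-- A family of subsets of the labels other than `r` that are pairwise nested or disjoint, each of
them and each of the complements having at least two elements. -/
structure IsLaminar (r : Fin n) (𝓑 : Finset (Finset (Fin n))) : Prop where
  notMem : ∀ A ∈ 𝓑, r ∉ A
  two_le : ∀ A ∈ 𝓑, 2 ≤ A.card
  card_le : ∀ A ∈ 𝓑, A.card + 2 ≤ n
  nested : ∀ A ∈ 𝓑, ∀ B ∈ 𝓑, A ⊆ B ∨ B ⊆ A ∨ Disjoint A B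

namespace IsLaminar

variable {r : Fin n} {𝓑 𝓒 : Finset (Finset (Fin n))}

lemma mono (h : IsLaminar r 𝓑) (h' : 𝓒 ⊆ 𝓑) : IsLaminar r 𝓒 where
  notMem A hA := h.notMem A (h' hA)
  two_le A hA := h.two_le A (h' hA)
  card_le A hA := h.card_le A (h' hA)
  nested A hA B hB := h.nested A (h' hA) B (h' hB)

lemma subset_or_subset (h : IsLaminar r 𝓑) {A B : Finset (Fin n)} (hA : A ∈ 𝓑) (hB : B ∈ 𝓑)
    {i : Fin n} (hiA : i ∈ A) (hiB : i ∈ B) : A ⊆ B ∨ B ⊆ A := by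
  rcases h.nested A hA B hB with h1 | h1 | h1
  · exact Or.inl h1
  · exact Or.inr h1
  · exact absurd hiB (Finset.disjoint_left.1 h1 hiA)

lemma subset_of_card_le (h : IsLaminar r 𝓑) {A B : Finset (Fin n)} (hA : A ∈ 𝓑) (hB : B ∈ 𝓑)
    {i : Fin n} (hiA : i ∈ A) (hiB : i ∈ B) (hc : A.card ≤ B.card) : A ⊆ B := by
  rcases h.subset_or_subset hA hB hiA hiB with h1 | h1
  · exact h1
  · exact (Finset.eq_of_subset_of_card_le h1 hc).ge

lemma exists_notMem (h : IsLaminar r 𝓑) {A : Finset (Fin n)} (hA : A ∈ 𝓑) :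
    ∃ k, k ∉ A ∧ k ≠ r := by
  by_contra! hh
  have h1 : (Finset.univ : Finset (Fin n)) ⊆ insert r A := fun k _ => by
    by_cases hk : k ∈ A
    · exact Finset.mem_insert_of_mem hk
    · rw [hh k hk]; exact Finset.mem_insert_self _ _
  have h2 := Finset.card_le_card h1
  rw [Finset.card_univ, Fintype.card_fin] at h2
  have := Finset.card_insert_le r A
  have := h.card_le A hA
  omega

/-- Labels that isolate a member of a laminar family. -/
lemma exists_isolating (h : IsLaminar r 𝓑) {A : Finset (Fin n)} (hA : A ∈ 𝓑) :
    ∃ i j k, i ∈ A ∧ j ∈ A ∧ i ≠ j ∧ k ∉ A ∧ k ≠ r ∧ (∀ B ∈ 𝓑, i ∈ B → j ∈ B → A ⊆ B) ∧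
      ∀ B ∈ 𝓑, A ⊂ B → k ∈ B := by
  classical
  -- Take `i` in a largest member strictly inside `A` and `j` in `A` outside it. A member strictly
  -- inside `A` containing both would lie in that largest one. If there is no member strictly
  -- inside, any two elements serve.
  have h1 : ∃ i j, i ∈ A ∧ j ∈ A ∧ i ≠ j ∧ ∀ B ∈ 𝓑, i ∈ B → j ∈ B → A ⊆ B := by
    by_cases hs : (𝓑.filter fun B => B ⊂ A).Nonempty
    · obtain ⟨B, hB, hmax⟩ := Finset.exists_max_image _ Finset.card hs
      rw [Finset.mem_filter] at hB
      obtain ⟨i, hi⟩ : B.Nonempty := Finset.card_pos.1 (by have := h.two_le B hB.1; omega)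
      obtain ⟨j, hj, hjB⟩ := Finset.exists_of_ssubset hB.2
      refine ⟨i, j, hB.2.1 hi, hj, fun e => hjB (e ▸ hi), fun C hC hiC hjC => ?_⟩
      rcases h.subset_or_subset hA hC (hB.2.1 hi) hiC with h2 | h2
      · exact h2
      · by_contra h3
        exact hjB (h.subset_of_card_le hC hB.1 hiC hi
          (hmax C (Finset.mem_filter.2 ⟨hC, h2, h3⟩)) hjC)
    · obtain ⟨i, hi, j, hj, hij⟩ := Finset.one_lt_card.1 (h.two_le A hA)
      refine ⟨i, j, hi, hj, hij, fun C hC hiC _ => ?_⟩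
      rcases h.subset_or_subset hA hC hi hiC with h2 | h2
      · exact h2
      · by_contra h3
        exact hs ⟨C, Finset.mem_filter.2 ⟨hC, h2, h3⟩⟩
  -- The members strictly containing `A` form a chain, so it suffices to take `k` outside `A` in the
  -- smallest of them.
  have h2 : ∃ k, k ∉ A ∧ k ≠ r ∧ ∀ B ∈ 𝓑, A ⊂ B → k ∈ B := by
    by_cases hs : (𝓑.filter fun B => A ⊂ B).Nonempty
    · obtain ⟨B, hB, hmin⟩ := Finset.exists_min_image _ Finset.card hs
      rw [Finset.mem_filter] at hB
      obtain ⟨k, hk, hkA⟩ := Finset.exists_of_ssubset hB.2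
      refine ⟨k, hkA, fun e => h.notMem B hB.1 (e ▸ hk), fun C hC hAC => ?_⟩
      obtain ⟨i, hi⟩ : A.Nonempty := Finset.card_pos.1 (by have := h.two_le A hA; omega)
      exact h.subset_of_card_le hB.1 hC (hB.2.1 hi) (hAC.1 hi)
        (hmin C (Finset.mem_filter.2 ⟨hC, hAC⟩)) hk
    · obtain ⟨k, hk, hkr⟩ := h.exists_notMem hA
      exact ⟨k, hk, hkr, fun B hB hAB => absurd ⟨B, Finset.mem_filter.2 ⟨hB, hAB⟩⟩ hs⟩
  obtain ⟨i, j, hi, hj, hij, h3⟩ := h1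
  obtain ⟨k, hk, hkr, h4⟩ := h2
  exact ⟨i, j, k, hi, hj, hij, hk, hkr, h3, h4⟩

/-- A laminar family contains a set that is the intersection of unions of its members. -/
lemma mem_of_forall (h : IsLaminar r 𝓑) {A : Finset (Fin n)} (h2 : 2 ≤ A.card)
    (hk : ∃ k, k ∉ A ∧ k ≠ r)
    (hsep : ∀ i ∈ A, ∀ j ∈ A, i ≠ j → ∀ k, k ∉ A → k ≠ r → ∃ B ∈ 𝓑, i ∈ B ∧ j ∈ B ∧ k ∉ B) :
    A ∈ 𝓑 := by
  classical
  obtain ⟨i, hi, j, hj, hij⟩ := Finset.one_lt_card.1 h2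
  -- Among the members containing `i` but not `k`, the largest contains every other one, since they
  -- share `i`. By `hsep` each `l ∈ A` lies in one of them.
  have hbig : ∀ k, k ∉ A → k ≠ r → ∃ B ∈ 𝓑, A ⊆ B ∧ k ∉ B := by
    intro k hk hkr
    have hne : (𝓑.filter fun B => i ∈ B ∧ k ∉ B).Nonempty := by
      obtain ⟨B, hB, hiB, -, hkB⟩ := hsep i hi j hj hij k hk hkr
      exact ⟨B, Finset.mem_filter.2 ⟨hB, hiB, hkB⟩⟩
    obtain ⟨B, hB, hmax⟩ := Finset.exists_max_image _ Finset.card hne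
    rw [Finset.mem_filter] at hB
    refine ⟨B, hB.1, fun l hl => ?_, hB.2.2⟩
    by_cases hil : i = l
    · exact hil ▸ hB.2.1
    obtain ⟨C, hC, hiC, hlC, hkC⟩ := hsep i hi l hl hil k hk hkr
    exact h.subset_of_card_le hC hB.1 hiC hB.2.1 (hmax C (Finset.mem_filter.2 ⟨hC, hiC, hkC⟩)) hlC
  have hne : (𝓑.filter fun B => A ⊆ B).Nonempty := by
    obtain ⟨k, hk, hkr⟩ := hk
    obtain ⟨B, hB, hAB, -⟩ := hbig k hk hkr
    exact ⟨B, Finset.mem_filter.2 ⟨hB, hAB⟩⟩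
  -- The smallest member containing `A` equals `A`: an extra label `k` would be excluded by some
  -- member containing `A`, which in turn contains `C`.
  obtain ⟨C, hC, hmin⟩ := Finset.exists_min_image _ Finset.card hne
  rw [Finset.mem_filter] at hC
  have : C ⊆ A := by
    intro k hkC
    by_contra hkA
    obtain ⟨B, hB, hAB, hkB⟩ := hbig k hkA fun e => h.notMem C hC.1 (e ▸ hkC)
    exact hkB (h.subset_of_card_le hC.1 hB (hC.2 hi) (hAB hi)
      (hmin B (Finset.mem_filter.2 ⟨hB, hAB⟩)) hkC)
  rw [Finset.Subset.antisymm hC.2 this]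
  exact hC.1

/-- For isolating labels `i, j, k` of `A`, the form is `(i|j)_r - (i|k)_r`. Both terms are 1 on
members strictly containing `A`, both are 0 on members strictly inside `A` or disjoint from it, and
on `A` itself only the first is 1. -/
lemma exists_dual (h : IsLaminar r 𝓑) : ∃ g : Finset (Fin n) → Q n →ₗ[ℝ] ℝ,
    (∀ A ∈ 𝓑, g A ∈ dualLattice (Lam n)) ∧
      ∀ A ∈ 𝓑, ∀ B ∈ 𝓑, g A (splitVec B) = if A = B then 1 else 0 := by
  have : ∀ A, ∃ g : Q n →ₗ[ℝ] ℝ, A ∈ 𝓑 → g ∈ dualLattice (Lam n) ∧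
      ∀ B ∈ 𝓑, g (splitVec B) = if A = B then 1 else 0 := by
    intro A
    by_cases hA : A ∈ 𝓑
    · obtain ⟨i, j, k, hi, hj, hij, hk, hkr, h1, h2⟩ := h.exists_isolating hA
      have hir : i ≠ r := fun e => h.notMem A hA (e ▸ hi)
      have hjr : j ≠ r := fun e => h.notMem A hA (e ▸ hj)
      have hik : i ≠ k := fun e => hk (e ▸ hi)
      refine ⟨gromovDiff r ⟨(i, j), hij, hir, hjr⟩ ⟨(i, k), hik, hir, hkr⟩, fun _ =>
        ⟨gromovDiff_mem_dualLattice _ _, fun B hB => ?_⟩⟩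
      rw [gromovDiff_splitVec _ _ (h.notMem B hB)]
      dsimp only
      by_cases hAB : A = B
      · subst hAB
        simp [hi, hj, hk]
      · rw [if_neg hAB]
        by_cases hiB : i ∈ B
        · rcases h.subset_or_subset hA hB hi hiB with h3 | h3
          · simp [hiB, h3 hj, h2 B hB (lt_of_le_of_ne h3 hAB)]
          · have hjB : j ∉ B := fun hjB => hAB (Finset.Subset.antisymm (h1 B hB hiB hjB) h3)
            have hkB : k ∉ B := fun hkB => hk (h3 hkB)
            simp [hjB, hkB]
        · simp [hiB]
    · exact ⟨0, fun hh => absurd hh hA⟩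
  choose g hg using this
  exact ⟨g, fun A hA => (hg A hA).1, fun A hA => (hg A hA).2⟩

lemma isFace (hn : 3 ≤ n) (h : IsLaminar r 𝓑) (h' : 𝓒 ⊆ 𝓑) :
    IsFace (Lam n) (conic 𝓒 splitVec) (conic 𝓑 splitVec) := by
  obtain ⟨g, hg, hgv⟩ := h.exists_dual
  exact isFace_conic (isLattice_Lam hn) h' _ g (fun A _ => splitVec_mem_Lam A) hg hgv

/-- Let a point have two expansions, and let `A ∈ 𝓑` have positive coefficient in the first. For
distinct `i, j ∈ A` and `k ∉ A`, `k ≠ r`, the form `(i|j)_r - (i|k)_r` is positive at the point, so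
some `B ∈ 𝓒` contains `i, j` but not `k`. By `mem_of_forall`, `A ∈ 𝓒`. -/
lemma conic_inter (h : IsLaminar r 𝓑) (h' : IsLaminar r 𝓒) :
    conic 𝓑 splitVec ∩ conic 𝓒 splitVec = conic (𝓑 ∩ 𝓒) (splitVec (n := n)) := by
  ext x
  constructor
  · rintro ⟨⟨a, ha, rfl⟩, ⟨b, hb, hab⟩⟩
    refine ⟨a, fun A hA => ha A (Finset.mem_inter.1 hA).1, ?_⟩
    refine (Finset.sum_subset Finset.inter_subset_left fun A hA hAt => ?_).symm
    have hA0 : ¬ 0 < a A := by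
      intro hpos
      refine hAt (Finset.mem_inter.2 ⟨hA, h'.mem_of_forall (h.two_le A hA)
        (h.exists_notMem hA) fun i hi j hj hij k hk hkr => ?_⟩)
      have hir : i ≠ r := fun e => h.notMem A hA (e ▸ hi)
      have hjr : j ≠ r := fun e => h.notMem A hA (e ▸ hj)
      have hik : i ≠ k := fun e => hk (e ▸ hi)
      have key := congrArg
        (gromovDiff r ⟨(i, j), hij, hir, hjr⟩ ⟨(i, k), hik, hir, hkr⟩) hab
      simp only [map_sum, map_smul, smul_eq_mul] at key
      -- No term is negative: a member containing `i` and `k` is comparable with `A`, hence contains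
      -- `A` and so also `j`.
      have hl : 0 < ∑ B ∈ 𝓑, a B * gromovDiff r ⟨(i, j), hij, hir, hjr⟩
          ⟨(i, k), hik, hir, hkr⟩ (splitVec B) := by
        refine Finset.sum_pos' (fun B hB => mul_nonneg (ha B hB) ?_) ⟨A, hA, mul_pos hpos ?_⟩
        · rw [gromovDiff_splitVec _ _ (h.notMem B hB)]
          dsimp only
          by_cases hikB : i ∈ B ∧ k ∈ B
          · rcases h.subset_or_subset hA hB hi hikB.1 with h3 | h3
            · simp [hikB.1, hikB.2, h3 hj]
            · exact absurd (h3 hikB.2) hk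
          · rw [if_neg hikB, sub_zero]
            split_ifs <;> norm_num
        · rw [gromovDiff_splitVec _ _ (h.notMem A hA)]
          simp [hi, hj, hk]
      rw [key] at hl
      by_contra! hno
      refine hl.not_ge (Finset.sum_nonpos fun B hB => mul_nonpos_of_nonneg_of_nonpos (hb B hB) ?_)
      rw [gromovDiff_splitVec _ _ (h'.notMem B hB)]
      dsimp only
      by_cases hijB : i ∈ B ∧ j ∈ B
      · simp [hijB.1, hijB.2, hno B hB hijB.1 hijB.2]
      · rw [if_neg hijB, zero_sub]
        split_ifs <;> norm_num
    rw [le_antisymm (not_lt.1 hA0) (ha A hA), zero_smul]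
  · rintro ⟨a, ha, rfl⟩
    have key : ∀ 𝓓 : Finset (Finset (Fin n)), 𝓑 ∩ 𝓒 ⊆ 𝓓 →
        ∑ A ∈ 𝓑 ∩ 𝓒, a A • splitVec A ∈ conic 𝓓 (splitVec (n := n)) := by
      intro 𝓓 h𝓓
      refine ⟨fun A => if A ∈ 𝓑 ∩ 𝓒 then a A else 0, fun A _ => ?_, ?_⟩
      · by_cases hA : A ∈ 𝓑 ∩ 𝓒
        · simp only [if_pos hA, ha A hA]
        · simp only [if_neg hA, le_rfl]
      · rw [← Finset.sum_subset h𝓓 fun A _ hA => by simp only [if_neg hA, zero_smul]]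
        exact Finset.sum_congr rfl fun A hA => by simp only [if_pos hA]
    exact ⟨key 𝓑 Finset.inter_subset_left, key 𝓒 Finset.inter_subset_right⟩

end IsLaminar

/-! ### Rooted trees -/

/-- A description of the tree `G` with root `ρ` by a parent function. -/
structure Rooting {V : Type} (G : SimpleGraph V) (ρ : V) where
  par : V → V
  depth : V → ℕ
  par_root : par ρ = ρ
  adj_par : ∀ x, x ≠ ρ → G.Adj x (par x)
  eq_par : ∀ x y, G.Adj x y → (x ≠ ρ ∧ par x = y) ∨ (y ≠ ρ ∧ par y = x)
  depth_par : ∀ x, x ≠ ρ → depth (par x) < depth x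

/-- The parent is the second vertex of the path to the root and the depth is the length of that
path. For adjacent `x, y`, either `y` lies on the path from `x`, and then comes second, or
prepending `y` gives the path from `y`. -/
lemma exists_rooting {V : Type} {G : SimpleGraph V} (hG : G.IsTree) (ρ : V) :
    Nonempty (Rooting G ρ) := by
  classical
  choose P hP using fun x => (hG.existsUnique_path x ρ).exists
  have huniq : ∀ {x} (p : G.Walk x ρ), p.IsPath → P x = p := fun {x} p hp =>
    (hG.existsUnique_path x ρ).unique (hP x) hp
  have hnil : ∀ x, x ≠ ρ → ¬ (P x).Nil := fun x hx => SimpleGraph.Walk.not_nil_of_ne hx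
  refine ⟨⟨fun x => (P x).snd, fun x => (P x).length, ?_, fun x hx => (P x).adj_snd (hnil x hx),
    ?_, ?_⟩⟩
  -- The second vertex of a trivial walk is by convention its only vertex, so the root is its own
  -- parent.
  · rw [huniq SimpleGraph.Walk.nil SimpleGraph.Walk.IsPath.nil]
    rfl
  · intro x y hxy
    by_cases hy : y ∈ (P x).support
    · refine Or.inl ⟨?_, (hG.isAcyclic.eq_snd_of_adj_start (hP x) hxy hy).symm⟩
      rintro rfl
      rw [huniq SimpleGraph.Walk.nil SimpleGraph.Walk.IsPath.nil] at hy
      simp only [SimpleGraph.Walk.support_nil, List.mem_singleton] at hy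
      exact hxy.ne hy.symm
    · refine Or.inr ⟨?_, ?_⟩
      · rintro rfl
        exact hy (P x).end_mem_support
      · rw [huniq (SimpleGraph.Walk.cons hxy.symm (P x)) ((hP x).cons hy)]
        exact SimpleGraph.Walk.snd_cons _ _
  · intro x hx
    rw [huniq (P x).tail (hP x).tail]
    have := SimpleGraph.Walk.length_tail_add_one (hnil x hx)
    omega

namespace Rooting

variable {V : Type} {G : SimpleGraph V} {ρ : V} (R : Rooting G ρ)

/-- The vertex `x` is `c` or a descendant of `c`. -/
def Desc (c x : V) : Prop := ∃ k : ℕ, R.par^[k] x = c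

lemma desc_refl (c : V) : R.Desc c c := ⟨0, rfl⟩

lemma desc_iff (c x : V) : R.Desc c x ↔ x = c ∨ R.Desc c (R.par x) := by
  constructor
  · rintro ⟨_ | k, hk⟩
    · exact Or.inl hk
    · exact Or.inr ⟨k, hk⟩
  · rintro (h | ⟨k, hk⟩)
    · exact ⟨0, h⟩
    · exact ⟨k + 1, hk⟩

lemma desc_root (c : V) : R.Desc c ρ ↔ ρ = c := by
  constructor
  · rintro ⟨k, hk⟩
    rw [Function.iterate_fixed R.par_root] at hk
    exact hk
  · rintro rfl
    exact R.desc_refl _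

lemma depth_le {c x : V} (h : R.Desc c x) : R.depth c ≤ R.depth x := by
  obtain ⟨k, hk⟩ := h
  induction k generalizing x with
  | zero => rw [← hk]; rfl
  | succ k ih =>
    refine (ih hk).trans ?_
    by_cases hx : x = ρ
    · rw [hx, R.par_root]
    · exact (R.depth_par x hx).le

lemma not_desc_par {c : V} (hc : c ≠ ρ) : ¬ R.Desc c (R.par c) := fun h =>
  (R.depth_le h).not_gt (R.depth_par c hc)

lemma desc_comparable {c c' x : V} (h : R.Desc c x) (h' : R.Desc c' x) :
    R.Desc c c' ∨ R.Desc c' c := by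
  obtain ⟨k, rfl⟩ := h
  obtain ⟨l, rfl⟩ := h'
  rcases le_total k l with hkl | hkl
  · refine Or.inr ⟨l - k, ?_⟩
    rw [← Function.iterate_add_apply, Nat.sub_add_cancel hkl]
  · refine Or.inl ⟨k - l, ?_⟩
    rw [← Function.iterate_add_apply, Nat.sub_add_cancel hkl]

lemma desc_trans {a b c : V} (h : R.Desc a b) (h' : R.Desc b c) : R.Desc a c := by
  obtain ⟨k, rfl⟩ := h
  obtain ⟨l, rfl⟩ := h'
  exact ⟨k + l, Function.iterate_add_apply _ _ _ _⟩

lemma desc_antisymm {a b : V} (h : R.Desc a b) (h' : R.Desc b a) : a = b := by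
  by_cases hb : b = ρ
  · rw [hb, desc_root] at h
    rw [hb, h]
  · rcases (R.desc_iff a b).1 h with h1 | h1
    · exact h1.symm
    · exact absurd ((R.depth_le h').trans (R.depth_le h1)) (R.depth_par b hb).not_ge

/-- The edge from `c` to its parent. -/
def edge (c : V) : Sym2 V := s(c, R.par c)

lemma edge_injOn : Set.InjOn R.edge {c | c ≠ ρ} := by
  intro c hc d hd h
  rcases Sym2.eq_iff.1 h with h1 | ⟨h1, h2⟩
  · exact h1.1
  · have h3 := R.depth_par c hc
    have h4 := R.depth_par d hd
    rw [h2] at h3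
    rw [← h1] at h4
    omega

lemma edge_mem {c : V} (hc : c ≠ ρ) : R.edge c ∈ G.edgeSet := R.adj_par c hc

lemma exists_edge {e : Sym2 V} (he : e ∈ G.edgeSet) : ∃ c, c ≠ ρ ∧ R.edge c = e := by
  induction e using Sym2.ind with
  | _ x y =>
    rcases R.eq_par x y he with ⟨h, rfl⟩ | ⟨h, rfl⟩
    · exact ⟨x, h, rfl⟩
    · exact ⟨y, h, Sym2.eq_swap⟩

lemma desc_iff_desc_iff {c x y : V} (hc : c ≠ ρ) (h : G.Adj x y) :
    (R.Desc c x ↔ R.Desc c y) ↔ s(x, y) ≠ R.edge c := by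
  have key : ∀ x, x ≠ ρ → ((R.Desc c x ↔ R.Desc c (R.par x)) ↔ s(x, R.par x) ≠ R.edge c) := by
    intro x hx
    by_cases hxc : x = c
    · subst hxc
      simp [edge, R.desc_refl, R.not_desc_par hc]
    · have h1 : s(x, R.par x) ≠ R.edge c := fun h => hxc (R.edge_injOn hx hc h)
      rw [R.desc_iff c x]
      simp [hxc, h1]
  rcases R.eq_par x y h with ⟨hx, rfl⟩ | ⟨hy, rfl⟩
  · exact key x hx
  · rw [iff_comm (a := R.Desc c _), Sym2.eq_swap]
    exact key y hy

/-- By `desc_iff_desc_iff`, a step of the walk enters or leaves the subtree below `c` exactly when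
it uses the edge above `c`, and a trail uses that edge at most once. -/
lemma edge_mem_edges_iff {c x y : V} (hc : c ≠ ρ) (p : G.Walk x y) (hp : p.IsTrail) :
    R.edge c ∈ p.edges ↔ ¬ (R.Desc c x ↔ R.Desc c y) := by
  induction p with
  | nil => simp
  | @cons u v w h p ih =>
    rw [SimpleGraph.Walk.isTrail_cons] at hp
    have ih := ih hp.1
    have h1 := R.desc_iff_desc_iff hc h
    rw [SimpleGraph.Walk.edges_cons, List.mem_cons]
    by_cases he : s(u, v) = R.edge c
    · rw [he] at hp
      have h2 := hp.2
      rw [he] at h1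
      tauto
    · have he' : R.edge c ≠ s(u, v) := Ne.symm he
      tauto

/-- Decreasing depth connects every vertex to the root, and every edge is the parent edge of a
non-root vertex, so there are at most `|V| - 1` edges. -/
lemma isTree [Finite V] (R : Rooting G ρ) : G.IsTree := by
  have hreach : ∀ k x, R.depth x ≤ k → G.Reachable x ρ := by
    intro k
    induction k with
    | zero =>
      intro x hx
      by_cases h : x = ρ
      · rw [h]
      · exact absurd (R.depth_par x h) (by omega)
    | succ k ih =>
      intro x hx
      by_cases h : x = ρ
      · rw [h]
      · exact (R.adj_par x h).reachable.trans (ih _ (by have := R.depth_par x h; omega))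
  have hconn : G.Connected := by
    have : Nonempty V := ⟨ρ⟩
    exact ⟨fun x y => (hreach _ x le_rfl).trans (hreach _ y le_rfl).symm⟩
  rw [SimpleGraph.isTree_iff_connected_and_card]
  refine ⟨hconn, le_antisymm ?_ hconn.card_vert_le_card_edgeSet_add_one⟩
  have h1 : G.edgeSet ⊆ R.edge '' {c | c ≠ ρ} := fun e he => by
    obtain ⟨c, hc, rfl⟩ := R.exists_edge he
    exact ⟨c, hc, rfl⟩
  have h2 : G.edgeSet.ncard ≤ ({ρ}ᶜ : Set V).ncard :=
    (Set.ncard_le_ncard h1).trans (Set.ncard_image_le (Set.toFinite _))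
  have h3 := Set.ncard_add_ncard_compl ({ρ} : Set V)
  rw [Set.ncard_singleton] at h3
  have h4 : Nat.card G.edgeSet = G.edgeSet.ncard := rfl
  omega

/-- In a set of vertices that is closed under passing to children, except for the children in `t`,
there is a vertex whose neighbours are its parent and vertices of `t`. -/
lemma exists_deepest [Finite V] {S t : Set V} (hS : S.Nonempty)
    (ht : ∀ y, y ≠ ρ → R.par y ∈ S → y ∈ S ∨ y ∈ t) :
    ∃ x ∈ S, ∀ y, G.Adj x y → (x ≠ ρ ∧ y = R.par x) ∨ y ∈ t := by
  obtain ⟨x, hx, hmax⟩ := Set.exists_max_image S R.depth (Set.toFinite _) hS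
  refine ⟨x, hx, fun y hxy => ?_⟩
  rcases R.eq_par x y hxy with ⟨h, rfl⟩ | ⟨h, h'⟩
  · exact Or.inl ⟨h, rfl⟩
  · rcases ht y h (h'.symm ▸ hx) with h1 | h1
    · have := R.depth_par y h
      rw [h'] at this
      exact absurd (hmax y h1) (by omega)
    · exact Or.inr h1

end Rooting

/-! ### The cone of a combinatorial type -/

namespace CombType

variable (T : CombType n)

/-- The vectors in `Q_n` of the metrizations of `T` are the combinations of the vectors of the
splits in `𝓑`. -/
def Realizes (𝓑 : Finset (Finset (Fin n))) : Prop :=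
  ∀ (K : Set ℝ) (x : Q n), (∃ len, (∀ e ∈ T.G.edgeSet, len e ∈ K) ∧ x = q n (T.distVec len)) ↔
    ∃ a : Finset (Fin n) → ℝ, (∀ A ∈ 𝓑, a A ∈ K) ∧ x = ∑ A ∈ 𝓑, a A • splitVec A

variable {ρ : T.V} (R : Rooting T.G ρ)

open Classical in
/-- The labels of the ends that are attached at descendants of `c`. -/
noncomputable def cluster (c : T.V) : Finset (Fin n) :=
  Finset.univ.filter fun i => R.Desc c (T.leg i)

lemma mem_cluster {c : T.V} {i : Fin n} : i ∈ T.cluster R c ↔ R.Desc c (T.leg i) := by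
  simp [cluster]

open Classical in
lemma pathLength_eq_sum [Fintype T.V] (len : Sym2 T.V → ℝ) (x y : T.V) :
    T.pathLength len x y = ∑ c ∈ Finset.univ.filter (· ≠ ρ),
      if (R.Desc c x ↔ R.Desc c y) then 0 else len (R.edge c) := by
  obtain ⟨p, hp, -⟩ := T.isTree.existsUnique_path x y
  rw [T.pathLength_eq len p hp, ← List.sum_toFinset _ hp.isTrail.edges_nodup]
  have h1 : p.edges.toFinset = ((Finset.univ.filter (· ≠ ρ)).filter
      fun c => ¬ (R.Desc c x ↔ R.Desc c y)).image R.edge := by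
    ext e
    simp only [List.mem_toFinset, Finset.mem_image, Finset.mem_filter, Finset.mem_univ, true_and]
    constructor
    · intro he
      obtain ⟨c, hc, rfl⟩ := R.exists_edge (p.edges_subset_edgeSet he)
      exact ⟨c, ⟨hc, (R.edge_mem_edges_iff hc p hp.isTrail).1 he⟩, rfl⟩
    · rintro ⟨c, ⟨hc, h⟩, rfl⟩
      exact (R.edge_mem_edges_iff hc p hp.isTrail).2 h
  rw [h1, Finset.sum_image, Finset.sum_filter]
  · exact Finset.sum_congr rfl fun c _ => by split_ifs <;> simp_all
  · intro c hc d hd h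
    exact R.edge_injOn (Finset.mem_filter.1 (Finset.mem_filter.1 hc).1).2
      (Finset.mem_filter.1 (Finset.mem_filter.1 hd).1).2 h

open Classical in
lemma q_distVec [Fintype T.V] (len : Sym2 T.V → ℝ) :
    q n (T.distVec len) = ∑ c ∈ Finset.univ.filter (· ≠ ρ),
      len (R.edge c) • splitVec (T.cluster R c) := by
  have : T.distVec len = ∑ c ∈ Finset.univ.filter (· ≠ ρ),
      len (R.edge c) • cutVec (T.cluster R c) := by
    funext ⟨p, hp⟩
    induction p using Sym2.ind with
    | _ i j =>
      change T.pathLength len (T.leg i) (T.leg j) = _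
      rw [T.pathLength_eq_sum R, Finset.sum_apply]
      refine Finset.sum_congr rfl fun c _ => ?_
      simp only [Pi.smul_apply, cutVec_mk, T.mem_cluster]
      split_ifs <;> simp
  rw [this, map_sum]
  simp only [map_smul, splitVec]

open Classical in
-- When distinct edges have distinct clusters, lengths on edges and coefficients on splits are the
-- same data, so any condition `K` on individual values transfers.
lemma realizes_of_injOn [Fintype T.V] (h : Set.InjOn (T.cluster R) {c | c ≠ ρ}) :
    T.Realizes ((Finset.univ.filter (· ≠ ρ)).image (T.cluster R)) := by
  intro K x
  have hS : ((Finset.univ.filter (· ≠ ρ) : Finset T.V) : Set T.V) = {c | c ≠ ρ} := by ext; simp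
  have hne : Nonempty T.V := ⟨ρ⟩
  constructor
  · rintro ⟨len, hlen, rfl⟩
    have hinv := h.leftInvOn_invFunOn
    refine ⟨fun A => len (R.edge (Function.invFunOn (T.cluster R) {c | c ≠ ρ} A)), ?_, ?_⟩
    · intro A hA
      obtain ⟨c, hc, rfl⟩ := Finset.mem_image.1 hA
      have hc := (Finset.mem_filter.1 hc).2
      simp only [hinv hc]
      exact hlen _ (R.edge_mem hc)
    · rw [T.q_distVec R, Finset.sum_image (by rw [hS]; exact h)]
      exact Finset.sum_congr rfl fun c hc => by simp only [hinv (Finset.mem_filter.1 hc).2]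
  · rintro ⟨a, ha, rfl⟩
    have hinv := R.edge_injOn.leftInvOn_invFunOn
    refine ⟨fun e => a (T.cluster R (Function.invFunOn R.edge {c | c ≠ ρ} e)), ?_, ?_⟩
    · intro e he
      obtain ⟨c, hc, rfl⟩ := R.exists_edge he
      simp only [hinv hc]
      exact ha _ (Finset.mem_image_of_mem _ (Finset.mem_filter.2 ⟨Finset.mem_univ _, hc⟩))
    · rw [T.q_distVec R, Finset.sum_image (by rw [hS]; exact h)]
      exact Finset.sum_congr rfl fun c hc => by simp only [hinv (Finset.mem_filter.1 hc).2]

lemma three_le_of_neighborSet_subset {x : T.V} {N : Set T.V} (h : T.G.neighborSet x ⊆ N) :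
    3 ≤ N.ncard + {i | T.leg i = x}.ncard := by
  have := T.finite
  have h1 := T.stable x
  have h2 := Set.ncard_le_ncard h
  rw [valence] at h1
  omega

/-- A deepest descendant of `c` has no neighbour except possibly its parent, so stability puts at
least two ends on it. -/
lemma two_le_card_cluster (c : T.V) : 2 ≤ (T.cluster R c).card := by
  have := T.finite
  obtain ⟨x, hx, h⟩ := R.exists_deepest (S := {x | R.Desc c x}) (t := ∅) ⟨c, R.desc_refl c⟩
    fun y _ h => Or.inl ((R.desc_iff c y).2 (Or.inr h))
  have h1 : T.G.neighborSet x ⊆ {R.par x} := fun y hy => by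
    rcases h y hy with h' | h'
    · exact h'.2
    · exact absurd h' (Set.notMem_empty y)
  have h2 := T.three_le_of_neighborSet_subset h1
  rw [Set.ncard_singleton] at h2
  have h3 : {i | T.leg i = x} ⊆ (T.cluster R c : Set (Fin n)) := fun i hi => by
    rw [Finset.mem_coe, T.mem_cluster, show T.leg i = x from hi]
    exact hx
  have h4 := Set.ncard_le_ncard h3
  rw [Set.ncard_coe_finset] at h4
  omega

/-- A deepest vertex `x` not below `c` has at most its parent and `c` as neighbours. If `x` is the
root, it carries at least two ends; otherwise it carries at least one, and `r` at the root is
another label outside the cluster. -/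
lemma card_cluster_add_two_le {r : Fin n} (hr : T.leg r = ρ) {c : T.V} (hc : c ≠ ρ) :
    (T.cluster R c).card + 2 ≤ n := by
  have := T.finite
  obtain ⟨x, hx, h⟩ := R.exists_deepest (S := {x | ¬ R.Desc c x}) (t := {c})
    ⟨ρ, fun h => hc ((R.desc_root c).1 h).symm⟩ fun y _ h => by
      by_cases hy : y = c
      · exact Or.inr hy
      · refine Or.inl fun hcy => ?_
        rcases (R.desc_iff c y).1 hcy with h1 | h1
        exacts [hy h1, h h1]
  have hcard : 2 ≤ (T.cluster R c)ᶜ.card := by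
    have h3 : {i | T.leg i = x} ⊆ ((T.cluster R c)ᶜ : Finset (Fin n)) := fun i hi => by
      rw [Finset.mem_coe, Finset.mem_compl, T.mem_cluster, show T.leg i = x from hi]
      exact hx
    rw [← Set.ncard_coe_finset]
    by_cases hxρ : x = ρ
    · have h1 : T.G.neighborSet x ⊆ {c} := fun y hy => by
        rcases h y hy with h' | h'
        · exact absurd hxρ h'.1
        · exact h'
      have h2 := T.three_le_of_neighborSet_subset h1
      rw [Set.ncard_singleton] at h2
      have h4 := Set.ncard_le_ncard h3
      omega
    · have h1 : T.G.neighborSet x ⊆ {R.par x, c} := fun y hy => by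
        rcases h y hy with h' | h'
        · exact Or.inl h'.2
        · exact Or.inr h'
      have h2 := T.three_le_of_neighborSet_subset h1
      have h5 := Set.ncard_insert_le (R.par x) {c}
      rw [Set.ncard_singleton] at h5
      have h6 : r ∉ {i | T.leg i = x} := fun h => hxρ ((show T.leg r = x from h).symm.trans hr)
      have h7 : insert r {i | T.leg i = x} ⊆ ((T.cluster R c)ᶜ : Finset (Fin n)) := by
        refine Set.insert_subset ?_ h3
        rw [Finset.mem_coe, Finset.mem_compl, T.mem_cluster, hr, R.desc_root]
        exact hc.symm
      have h4 := Set.ncard_le_ncard h7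
      rw [Set.ncard_insert_of_notMem h6] at h4
      omega
  rw [Finset.card_compl, Fintype.card_fin] at hcard
  omega

lemma cluster_subset {c d : T.V} (h : R.Desc c d) : T.cluster R d ⊆ T.cluster R c := fun i hi => by
  rw [mem_cluster] at hi ⊢
  exact R.desc_trans h hi

lemma cluster_nested (c d : T.V) : T.cluster R c ⊆ T.cluster R d ∨
    T.cluster R d ⊆ T.cluster R c ∨ Disjoint (T.cluster R c) (T.cluster R d) := by
  by_cases h : Disjoint (T.cluster R c) (T.cluster R d)
  · exact Or.inr (Or.inr h)
  · obtain ⟨i, hi, hi'⟩ := Finset.not_disjoint_iff.1 h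
    rcases R.desc_comparable ((T.mem_cluster R).1 hi) ((T.mem_cluster R).1 hi') with h1 | h1
    · exact Or.inr (Or.inl (T.cluster_subset R h1))
    · exact Or.inl (T.cluster_subset R h1)

/-- If `d` is strictly below `c`, a deepest vertex below `c` but not below `d` has at most its
parent and `d` as neighbours. By stability it carries an end, which distinguishes the clusters.
Vertices with equal clusters are comparable because clusters are nonempty. -/
lemma cluster_injOn : Set.InjOn (T.cluster R) {c | c ≠ ρ} := by
  have := T.finite
  have key : ∀ c d : T.V, c ≠ ρ → R.Desc c d → T.cluster R c = T.cluster R d → c = d := by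
    intro c d hc hcd h
    by_contra hne
    obtain ⟨x, hx, hN⟩ := R.exists_deepest (S := {x | R.Desc c x ∧ ¬ R.Desc d x}) (t := {d})
      ⟨c, R.desc_refl c, fun h' => hne (R.desc_antisymm hcd h')⟩ fun y _ h' => by
        by_cases hy : y = d
        · exact Or.inr hy
        · refine Or.inl ⟨(R.desc_iff c y).2 (Or.inr h'.1), fun hdy => ?_⟩
          rcases (R.desc_iff d y).1 hdy with h1 | h1
          exacts [hy h1, h'.2 h1]
    have h1 : T.G.neighborSet x ⊆ {R.par x, d} := fun y hy => by
      rcases hN y hy with h' | h'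
      · exact Or.inl h'.2
      · exact Or.inr h'
    have h2 := T.three_le_of_neighborSet_subset h1
    have h5 := Set.ncard_insert_le (R.par x) {d}
    rw [Set.ncard_singleton] at h5
    obtain ⟨i, hi⟩ : {i | T.leg i = x}.Nonempty :=
      (Set.ncard_pos (Set.toFinite _)).1 (by omega)
    have hi : T.leg i = x := hi
    have h6 : i ∈ T.cluster R c := (T.mem_cluster R).2 (hi ▸ hx.1)
    rw [h, T.mem_cluster, hi] at h6
    exact hx.2 h6
  intro c hc d hd h
  obtain ⟨i, hi⟩ : (T.cluster R c).Nonempty :=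
    Finset.card_pos.1 (by have := T.two_le_card_cluster R c; omega)
  have hi' := hi
  rw [h] at hi'
  rcases R.desc_comparable ((T.mem_cluster R).1 hi) ((T.mem_cluster R).1 hi') with h1 | h1
  · exact key c d hc h1 h
  · exact (key d c hd h1 h.symm).symm

lemma exists_realizes (r : Fin n) : ∃ 𝓑, IsLaminar r 𝓑 ∧ T.Realizes 𝓑 := by
  classical
  have := T.finite
  have := Fintype.ofFinite T.V
  obtain ⟨R⟩ := exists_rooting T.isTree (T.leg r)
  refine ⟨_, ⟨?_, ?_, ?_, ?_⟩, T.realizes_of_injOn R (T.cluster_injOn R)⟩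
  · intro A hA
    obtain ⟨c, hc, rfl⟩ := Finset.mem_image.1 hA
    rw [T.mem_cluster, R.desc_root]
    exact fun h => (Finset.mem_filter.1 hc).2 h.symm
  · intro A hA
    obtain ⟨c, -, rfl⟩ := Finset.mem_image.1 hA
    exact T.two_le_card_cluster R c
  · intro A hA
    obtain ⟨c, hc, rfl⟩ := Finset.mem_image.1 hA
    exact T.card_cluster_add_two_le R rfl (Finset.mem_filter.1 hc).2
  · intro A hA B hB
    obtain ⟨c, -, rfl⟩ := Finset.mem_image.1 hA
    obtain ⟨d, -, rfl⟩ := Finset.mem_image.1 hB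
    exact T.cluster_nested R c d

end CombType

/-! ### Trees of laminar families -/

lemma Rooting.exists_child {V : Type} {G : SimpleGraph V} {ρ : V} (R : Rooting G ρ) {c x : V}
    (h : R.Desc c x) (hx : x ≠ c) : ∃ y, y ≠ c ∧ R.par y = c ∧ R.Desc y x := by
  obtain ⟨k, hk⟩ := h
  induction k generalizing x with
  | zero => exact absurd hk hx
  | succ k ih =>
    by_cases hp : R.par x = c
    · exact ⟨x, hx, hp, R.desc_refl x⟩
    · obtain ⟨y, h1, h2, h3⟩ := ih hp hk
      exact ⟨y, h1, h2, (R.desc_iff y x).2 (Or.inr h3)⟩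

namespace IsLaminar

variable {r : Fin n} {𝓑 : Finset (Finset (Fin n))}

/-- Members satisfying `P` share the label `i`, so they form a chain and minimal cardinality means
smallest. Adding the full set, which serves as the root, preserves this. -/
lemma exists_smallest (h : IsLaminar r 𝓑) {P : Finset (Fin n) → Prop} {i : Fin n}
    (hi : ∀ A, P A → i ∈ A) (hP : P Finset.univ) :
    ∃ B : {A // A ∈ insert Finset.univ 𝓑}, P B.1 ∧
      ∀ C : {A // A ∈ insert Finset.univ 𝓑}, P C.1 → B.1 ⊆ C.1 := by
  classical
  have hne : ((insert Finset.univ 𝓑).filter P).Nonempty :=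
    ⟨Finset.univ, Finset.mem_filter.2 ⟨Finset.mem_insert_self _ _, hP⟩⟩
  obtain ⟨B, hB, hmin⟩ := Finset.exists_min_image _ Finset.card hne
  rw [Finset.mem_filter] at hB
  refine ⟨⟨B, hB.1⟩, hB.2, fun ⟨C, hC⟩ hPC => ?_⟩
  have hcard := hmin C (Finset.mem_filter.2 ⟨hC, hPC⟩)
  dsimp only
  rcases Finset.mem_insert.1 hC with rfl | hC
  · exact Finset.subset_univ _
  · rcases Finset.mem_insert.1 hB.1 with rfl | hB'
    · rw [Finset.eq_of_subset_of_card_le (Finset.subset_univ C) hcard]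
    · exact h.subset_of_card_le hB' hC (hi _ hB.2) (hi _ hPC) hcard

/-- The tree is the Hasse diagram of inclusion on the family with the full set adjoined: the parent
is the smallest strictly larger member. -/
lemma exists_rooting (h : IsLaminar r 𝓑) :
    ∃ (ρ : {A // A ∈ insert Finset.univ 𝓑}) (G : SimpleGraph {A // A ∈ insert Finset.univ 𝓑})
      (R : Rooting G ρ), ρ.1 = Finset.univ ∧ ∀ c x, R.Desc c x ↔ x.1 ⊆ c.1 := by
  classical
  let ρ : {A // A ∈ insert Finset.univ 𝓑} := ⟨Finset.univ, Finset.mem_insert_self _ _⟩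
  have hpar : ∀ x : {A // A ∈ insert Finset.univ 𝓑},
      ∃ y : {A // A ∈ insert Finset.univ 𝓑}, (x = ρ → y = ρ) ∧
        (x ≠ ρ → x.1 ⊂ y.1 ∧
          ∀ C : {A // A ∈ insert Finset.univ 𝓑}, x.1 ⊂ C.1 → y.1 ⊆ C.1) := by
    intro x
    by_cases hx : x = ρ
    · exact ⟨ρ, fun _ => rfl, fun h => absurd hx h⟩
    · have hxu : x.1 ≠ Finset.univ := fun e => hx (Subtype.ext e)
      have hxB : x.1 ∈ 𝓑 := (Finset.mem_insert.1 x.2).resolve_left hxu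
      obtain ⟨i, hi⟩ : x.1.Nonempty := Finset.card_pos.1 (by have := h.two_le _ hxB; omega)
      obtain ⟨y, hy⟩ := h.exists_smallest (P := fun A => x.1 ⊂ A) (fun A hA => hA.1 hi)
        (Finset.ssubset_univ_iff.2 hxu)
      exact ⟨y, fun e => absurd e hx, fun _ => hy⟩
  choose par hpar0 hpar1 using hpar
  let G : SimpleGraph {A // A ∈ insert Finset.univ 𝓑} := SimpleGraph.fromRel fun x y => par x = y
  have hadj : ∀ x y, G.Adj x y ↔ x ≠ y ∧ (par x = y ∨ par y = x) := fun x y => Iff.rfl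
  have hne : ∀ x, x ≠ ρ → x ≠ par x := fun x hx e =>
    (hpar1 x hx).1.ne (congrArg Subtype.val e)
  let R : Rooting G ρ :=
    { par := par
      depth := fun x => n - x.1.card
      par_root := hpar0 ρ rfl
      adj_par := fun x hx => (hadj _ _).2 ⟨hne x hx, Or.inl rfl⟩
      eq_par := fun x y hxy => by
        obtain ⟨h1, h2 | h2⟩ := (hadj x y).1 hxy
        · refine Or.inl ⟨fun e => h1 ?_, h2⟩
          rw [← h2, hpar0 x e, e]
        · refine Or.inr ⟨fun e => h1 ?_, h2⟩
          rw [← h2, hpar0 y e, e]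
      depth_par := fun x hx => by
        have h1 := Finset.card_lt_card (hpar1 x hx).1
        have h2 := Finset.card_le_univ (par x).1
        rw [Fintype.card_fin] at h2
        omega }
  have hsub : ∀ x, x.1 ⊆ (par x).1 := fun x => by
    by_cases hx : x = ρ
    · rw [hpar0 x hx]; exact Finset.subset_univ _
    · exact (hpar1 x hx).1.1
  refine ⟨ρ, G, R, rfl, fun c x => ⟨?_, ?_⟩⟩
  · rintro ⟨k, hk⟩
    induction k generalizing x with
    | zero => rw [← hk]; rfl
    | succ k ih => exact (hsub x).trans (ih _ hk)
  · induction hm : R.depth x using Nat.strong_induction_on generalizing x with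
    | _ m ih =>
      intro hxc
      refine (R.desc_iff c x).2 ?_
      by_cases hxc' : x = c
      · exact Or.inl hxc'
      · have hx : x ≠ ρ := by
          rintro rfl
          exact hxc' (Subtype.ext (Finset.univ_subset_iff.1 hxc).symm)
        exact Or.inr (ih _ (hm ▸ R.depth_par x hx) _ rfl ((hpar1 x hx).2 c
          (lt_of_le_of_ne hxc fun e => hxc' (Subtype.ext e))))

/-- The end `x_i` is attached at the smallest member containing `i`, so the cluster of a vertex is
the vertex itself as a set; `x_r` sits at the root. -/
lemma exists_combType (hn : 3 ≤ n) (h : IsLaminar r 𝓑) :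
    ∃ T : CombType n, T.Realizes 𝓑 := by
  classical
  obtain ⟨ρ, G, R, hρ, hR⟩ := h.exists_rooting
  have hmem : ∀ x : {A // A ∈ insert Finset.univ 𝓑}, x ≠ ρ → x.1 ∈ 𝓑 := fun x hx =>
    (Finset.mem_insert.1 x.2).resolve_left fun e => hx (Subtype.ext (e.trans hρ.symm))
  choose leg hleg1 hleg2 using fun i : Fin n =>
    h.exists_smallest (P := fun A => i ∈ A) (fun A hA => hA) (Finset.mem_univ i)
  have hlegr : leg r = ρ := by
    by_contra hne
    exact h.notMem _ (hmem _ hne) (hleg1 r)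
  have hcl : ∀ i c, R.Desc c (leg i) ↔ i ∈ c.1 := fun i c =>
    (hR c _).trans ⟨fun hs => hs (hleg1 i), hleg2 i c⟩
  have hstable : ∀ x, 3 ≤ valence G leg x := by
    intro x
    set N : Set {A // A ∈ insert Finset.univ 𝓑} := {y | y ≠ x ∧ R.par y = x}
    set L : Set (Fin n) := {i | leg i = x ∧ i ≠ r}
    have hcover : ∀ i ∈ x.1, i ≠ r → i ∈ L ∨ ∃ y ∈ N, i ∈ y.1 := by
      intro i hi hir
      by_cases hix : leg i = x
      · exact Or.inl ⟨hix, hir⟩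
      · obtain ⟨y, h1, h2, h3⟩ := R.exists_child ((hcl i x).2 hi) hix
        exact Or.inr ⟨y, ⟨h1, h2⟩, (hcl i y).1 h3⟩
    have hNρ : ∀ y ∈ N, y ≠ ρ := by
      rintro y ⟨h1, h2⟩ rfl
      exact h1 (R.par_root.symm.trans h2)
    have hNG : ∀ y ∈ N, G.Adj x y := fun y hy => by
      have := R.adj_par y (hNρ y hy)
      rw [hy.2] at this
      exact this.symm
    have hchild : ∀ y ∈ N, ∃ j ∈ x.1, j ≠ r ∧ j ∉ y.1 := by
      intro y hy
      by_cases hx : x = ρ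
      · obtain ⟨j, hj, hjr⟩ := h.exists_notMem (hmem y (hNρ y hy))
        exact ⟨j, by rw [hx, hρ]; exact Finset.mem_univ j, hjr, hj⟩
      · have hyx : y.1 ⊆ x.1 := (hR x y).1 ((R.desc_iff x y).2 (Or.inr (hy.2 ▸ R.desc_refl _)))
        obtain ⟨j, hj, hjy⟩ := Finset.exists_of_ssubset
          (lt_of_le_of_ne hyx fun e => hy.1 (Subtype.ext e))
        exact ⟨j, hj, fun e => h.notMem _ (hmem x hx) (e ▸ hj), hjy⟩
    have hx2 : 2 ≤ (x.1.erase r).card := by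
      by_cases hx : x = ρ
      · rw [hx, hρ, Finset.card_erase_of_mem (Finset.mem_univ r), Finset.card_univ,
          Fintype.card_fin]
        omega
      · rw [Finset.erase_eq_of_notMem (h.notMem _ (hmem x hx))]
        exact h.two_le _ (hmem x hx)
    -- Every label of `x` other than `r` is attached at `x` or lies in a child. Without children at
    -- least two ends are attached. With a child `y`, a label of `x` outside `y` provides a further
    -- end or child.
    have h2 : 2 ≤ N.ncard + L.ncard := by
      rcases N.eq_empty_or_nonempty with hN | ⟨y, hy⟩
      · have h1 : ((x.1.erase r : Finset (Fin n)) : Set (Fin n)) ⊆ L := by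
          intro i hi
          rw [Finset.mem_coe, Finset.mem_erase] at hi
          rcases hcover i hi.2 hi.1 with h' | ⟨y, hy, -⟩
          · exact h'
          · rw [hN] at hy
            exact absurd hy (Set.notMem_empty y)
        have := Set.ncard_le_ncard h1
        rw [Set.ncard_coe_finset] at this
        omega
      · obtain ⟨j, hj, hjr, hjy⟩ := hchild y hy
        rcases hcover j hj hjr with h' | ⟨y', hy', hjy'⟩
        · have h3 := (Set.ncard_pos (Set.toFinite L)).2 ⟨j, h'⟩
          have h4 := (Set.ncard_pos (Set.toFinite N)).2 ⟨y, hy⟩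
          omega
        · have hyy' : y ≠ y' := fun e => hjy (e ▸ hjy')
          have h3 : ({y, y'} : Set _) ⊆ N := Set.insert_subset hy (Set.singleton_subset_iff.2 hy')
          have := Set.ncard_le_ncard h3
          rw [Set.ncard_pair hyy'] at this
          omega
    rw [valence]
    -- The third flag is the end `x_r` at the root, and the edge to the parent elsewhere.
    by_cases hx : x = ρ
    · have h3 : insert r L ⊆ {i | leg i = x} :=
        Set.insert_subset (hlegr.trans hx.symm) fun i hi => hi.1
      have h4 := Set.ncard_le_ncard h3
      rw [Set.ncard_insert_of_notMem fun hr => hr.2 rfl] at h4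
      have h5 : N ⊆ G.neighborSet x := hNG
      have h6 := Set.ncard_le_ncard h5
      omega
    · have h3 : L ⊆ {i | leg i = x} := fun i hi => hi.1
      have h4 := Set.ncard_le_ncard h3
      have h5 : insert (R.par x) N ⊆ G.neighborSet x := Set.insert_subset (R.adj_par x hx) hNG
      have h6 := Set.ncard_le_ncard h5
      rw [Set.ncard_insert_of_notMem fun hp => by
        have h7 := R.depth_par x hx
        have h8 := R.depth_par _ (hNρ _ hp)
        rw [hp.2] at h8
        omega] at h6
      omega
  let T : CombType n :=
    { V := {A // A ∈ insert Finset.univ 𝓑}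
      finite := inferInstance
      G := G
      isTree := R.isTree
      leg := leg
      stable := hstable }
  refine ⟨T, ?_⟩
  have hcluster : ∀ c, T.cluster (ρ := ρ) R c = c.1 := fun c => by
    ext i
    rw [T.mem_cluster]
    exact hcl i c
  have : Fintype T.V := Fintype.ofFinite _
  convert T.realizes_of_injOn (ρ := ρ) R (fun c _ d _ hcd => Subtype.ext (by
    rw [← hcluster c, ← hcluster d]; exact hcd)) using 1
  ext A
  simp only [Finset.mem_image, Finset.mem_filter, Finset.mem_univ, true_and]
  constructor
  · intro hA
    refine ⟨⟨A, Finset.mem_insert_of_mem hA⟩, fun e => ?_, hcluster _⟩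
    have : A = Finset.univ := (congrArg Subtype.val e).trans hρ
    exact h.notMem A hA (this ▸ Finset.mem_univ r)
  · rintro ⟨c, hc, rfl⟩
    rw [hcluster]
    exact hmem c hc

end IsLaminar

/-! ### The forgetful map -/

lemma straightenLen_of_adj {V : Type} {G : SimpleGraph V} {v : V} (len : Sym2 V → ℝ)
    {a b : {w : V // w ≠ v}} (h : G.Adj a b) : straightenLen G v len s(a, b) = len s(↑a, ↑b) :=
  if_pos h

lemma straightenLen_of_not_adj {V : Type} {G : SimpleGraph V} {v : V} (len : Sym2 V → ℝ)
    {a b : {w : V // w ≠ v}} (h : ¬ G.Adj a b) :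
    straightenLen G v len s(a, b) = len s(↑a, v) + len s(v, ↑b) :=
  if_neg h

/-- A path between vertices different from `v` gives a path of the same length after straightening
the vertex `v`. -/
lemma exists_straighten_path {V : Type} {G : SimpleGraph V} (hG : G.IsTree) (v : V)
    (len : Sym2 V → ℝ) {x y : V} (hx : x ≠ v) (hy : y ≠ v) (p : G.Walk x y) (hp : p.IsPath) :
    ∃ p' : (straighten G v).Walk ⟨x, hx⟩ ⟨y, hy⟩, p'.IsPath ∧
      (∀ z ∈ p'.support, (z : V) ∈ p.support) ∧
      (p'.edges.map (straightenLen G v len)).sum = (p.edges.map len).sum := by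
  induction hm : p.length using Nat.strong_induction_on generalizing x with
  | _ m ih =>
    cases p with
    | nil => exact ⟨SimpleGraph.Walk.nil, SimpleGraph.Walk.IsPath.nil, by simp, by simp⟩
    | @cons _ u _ h p =>
      rw [SimpleGraph.Walk.cons_isPath_iff] at hp
      rw [SimpleGraph.Walk.length_cons] at hm
      by_cases hu : u = v
      -- The two steps through the straightened vertex become one edge. Its endpoints are not
      -- adjacent in the tree, so its length is by definition the sum of the two.
      · subst hu
        cases p with
        | nil => exact absurd rfl hy
        | @cons _ w _ h' p =>
          rw [SimpleGraph.Walk.cons_isPath_iff, SimpleGraph.Walk.support_cons,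
            List.mem_cons, not_or] at hp
          rw [SimpleGraph.Walk.length_cons] at hm
          have hw : w ≠ u := h'.ne'
          obtain ⟨p', h1, h2, h3⟩ := ih p.length (by omega) hw p hp.1.1 rfl
          have hxw : x ≠ w := fun e => hp.2.2 (e ▸ p.start_mem_support)
          have hadj : (straighten G u).Adj ⟨x, hx⟩ ⟨w, hw⟩ :=
            Or.inr ⟨fun e => hxw (Subtype.ext_iff.1 e), h, h'⟩
          refine ⟨SimpleGraph.Walk.cons hadj p', h1.cons fun hh => hp.2.2 (h2 _ hh), ?_, ?_⟩
          · intro z hz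
            rw [SimpleGraph.Walk.support_cons, List.mem_cons] at hz
            simp only [SimpleGraph.Walk.support_cons, List.mem_cons]
            rcases hz with rfl | hz
            · exact Or.inl rfl
            · exact Or.inr (Or.inr (h2 z hz))
          · simp only [SimpleGraph.Walk.edges_cons, List.map_cons, List.sum_cons]
            rw [h3, straightenLen_of_not_adj len (not_adj_of_adj_adj hG h h')]
            ring
      · obtain ⟨p', h1, h2, h3⟩ := ih p.length (by omega) hu p hp.1 rfl
        have hadj : (straighten G v).Adj ⟨x, hx⟩ ⟨u, hu⟩ := Or.inl h
        refine ⟨SimpleGraph.Walk.cons hadj p', h1.cons fun hh => hp.2 (h2 _ hh), ?_, ?_⟩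
        · intro z hz
          rw [SimpleGraph.Walk.support_cons, List.mem_cons] at hz ⊢
          rcases hz with rfl | hz
          · exact Or.inl rfl
          · exact Or.inr (h2 z hz)
        · simp only [SimpleGraph.Walk.edges_cons, List.map_cons, List.sum_cons]
          rw [h3, straightenLen_of_adj len (a := ⟨x, hx⟩) (b := ⟨u, hu⟩) h]

namespace CombType

variable (hn : 3 ≤ n) (T : CombType (n + 1)) (h : valence T.G T.leg T.lastVertex = 3)

lemma pathLength_forgetStraighten (len : Sym2 T.V → ℝ) {x y : T.V} (hx : x ≠ T.lastVertex)
    (hy : y ≠ T.lastVertex) :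
    (T.forgetStraighten hn h).pathLength (straightenLen T.G T.lastVertex len) ⟨x, hx⟩ ⟨y, hy⟩ =
      T.pathLength len x y := by
  obtain ⟨p, hp, -⟩ := T.isTree.existsUnique_path x y
  obtain ⟨p', h1, -, h3⟩ := exists_straighten_path T.isTree T.lastVertex len hx hy p hp
  rw [T.pathLength_eq len p hp, ← h3]
  exact (T.forgetStraighten hn h).pathLength_eq _ p' h1

lemma initLeg_eq_lastVertex (h : valence T.G T.leg T.lastVertex = 3) {u : T.V}
    (hu : T.G.Adj T.lastVertex u) {i j : Fin n} (hi : T.initLeg i = T.lastVertex)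
    (hj : T.initLeg j = T.lastVertex) : i = j := by
  have := T.finite
  have h1 := T.valence_lastVertex
  rw [h, valence] at h1
  have h2 : 0 < (T.G.neighborSet T.lastVertex).ncard := (Set.ncard_pos (Set.toFinite _)).2 ⟨u, hu⟩
  exact (Set.ncard_le_one (Set.toFinite _)).1
    (show {i | T.initLeg i = T.lastVertex}.ncard ≤ 1 by omega) i hi j hj

lemma eq_of_adj_lastVertex (h : valence T.G T.leg T.lastVertex = 3) {u w : T.V}
    (hu : T.G.Adj T.lastVertex u) (hw : T.G.Adj T.lastVertex w) {i : Fin n}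
    (hi : T.initLeg i = T.lastVertex) : w = u := by
  have := T.finite
  have h1 := T.valence_lastVertex
  rw [h, valence] at h1
  have h2 : 0 < {i | T.initLeg i = T.lastVertex}.ncard := (Set.ncard_pos (Set.toFinite _)).2 ⟨i, hi⟩
  exact (Set.ncard_le_one (Set.toFinite _)).1
    (show (T.G.neighborSet T.lastVertex).ncard ≤ 1 by omega) w hw u hu

open Classical in
-- If the removed vertex joins two bounded edges, their lengths add up and no distance changes. If
-- it joins a bounded edge to an end `x_i`, that edge becomes part of `x_i`; the lost length is the
-- entry `a i`, and all other entries are 0.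
lemma pr_distVec_forgetStraighten (len : Sym2 T.V → ℝ) :
    ∃ a, pr n (T.distVec len) = (T.forgetStraighten hn h).distVec
      (straightenLen T.G T.lastVertex len) + Phi n a := by
  have hex := T.exists_adj_lastVertex hn h
  have hu := adj_straightenVertex_self T.G T.lastVertex hex
  set u := straightenVertex T.G T.lastVertex hex T.lastVertex with hudef
  have hleg : ∀ i, (T.forgetStraighten hn h).leg i =
    straightenVertex T.G T.lastVertex hex (T.initLeg i) := fun i => rfl
  -- With another end at the removed vertex, `u` is its only neighbour, so every path leaving it
  -- starts with the edge to `u`.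
  have hlast : ∀ {i}, T.initLeg i = T.lastVertex → ∀ y (hy : y ≠ T.lastVertex),
      T.pathLength len T.lastVertex y = (T.forgetStraighten hn h).pathLength
        (straightenLen T.G T.lastVertex len) u ⟨y, hy⟩ + len s(T.lastVertex, ↑u) := by
    intro i hi y hy
    obtain ⟨p, hp, -⟩ := T.isTree.existsUnique_path T.lastVertex y
    rw [T.pathLength_eq len p hp]
    cases p with
    | nil => exact absurd rfl hy
    | @cons _ w _ hvw p =>
      obtain rfl := T.eq_of_adj_lastVertex h hu hvw hi
      rw [SimpleGraph.Walk.cons_isPath_iff] at hp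
      have key := T.pathLength_forgetStraighten hn h len u.2 hy
      rw [T.pathLength_eq len p hp.1] at key
      rw [SimpleGraph.Walk.edges_cons, List.map_cons, List.sum_cons, add_comm]
      exact congrArg (· + len s(T.lastVertex, ↑u)) key.symm
  refine ⟨fun i => if T.initLeg i = T.lastVertex then len s(T.lastVertex, ↑u) else 0, ?_⟩
  funext ⟨p, hp⟩
  induction p using Sym2.ind with
  | _ i j =>
    have hij : i ≠ j := hp
    change T.pathLength len (T.initLeg i) (T.initLeg j) =
      (T.forgetStraighten hn h).pathLength (straightenLen T.G T.lastVertex len)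
        ((T.forgetStraighten hn h).leg i) ((T.forgetStraighten hn h).leg j) +
      ((if T.initLeg i = T.lastVertex then len s(T.lastVertex, ↑u) else 0) +
        (if T.initLeg j = T.lastVertex then len s(T.lastVertex, ↑u) else 0))
    rw [hleg, hleg]
    by_cases hi : T.initLeg i = T.lastVertex
    · have hj : T.initLeg j ≠ T.lastVertex := fun hj => hij (T.initLeg_eq_lastVertex h hu hi hj)
      rw [if_pos hi, if_neg hj, hi, ← hudef, straightenVertex_of_ne _ _ _ hj, hlast hi _ hj,
        add_zero]
    · rw [if_neg hi, straightenVertex_of_ne _ _ _ hi, zero_add]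
      by_cases hj : T.initLeg j = T.lastVertex
      · rw [if_pos hj, hj, ← hudef, T.pathLength_comm, hlast hj _ hi]
        exact congrArg (· + len s(T.lastVertex, ↑u)) (pathLength_comm _ _ _ _)
      · rw [if_neg hj, straightenVertex_of_ne _ _ _ hj, add_zero,
          T.pathLength_forgetStraighten hn h len hi hj]

end CombType

lemma prQ_phi (hn : 3 ≤ n) (C : M0n (n + 1)) : prQ n (phi (n + 1) C) = phi n (ft hn C) := by
  induction C using Quotient.inductionOn with
  | _ C =>
    change q n (pr n (C.distVec C.len)) = q n ((C.forget hn).distVec (C.forget hn).len)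
    by_cases h : valence C.G C.leg C.lastVertex = 3
    · rw [Curve.forget, dif_pos h]
      obtain ⟨a, ha⟩ := C.pr_distVec_forgetStraighten hn h C.len
      rw [ha, map_add]
      have : q n (Phi n a) = 0 := (Submodule.Quotient.mk_eq_zero _).2 ⟨a, rfl⟩
      rw [this, add_zero]
    · rw [Curve.forget, dif_neg h]
      congr 1
      funext ⟨p, hp⟩
      induction p using Sym2.ind with
      | _ i j => rfl

/-! ### The fan -/

/-- The closed cone is the case `K = [0, ∞)`; `K = (0, ∞)`, used in `support_m0nFan`, corresponds to
actual curves. -/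
lemma CombType.Realizes.cone_eq {T : CombType n} {𝓑 : Finset (Finset (Fin n))}
    (h : T.Realizes 𝓑) : T.cone = conic 𝓑 splitVec := by
  ext x
  exact h (Set.Ici 0) x

lemma mem_m0nFan_iff (hn : 3 ≤ n) (r : Fin n) {σ : Set (Q n)} :
    σ ∈ m0nFan n ↔ ∃ 𝓑, IsLaminar r 𝓑 ∧ σ = conic 𝓑 splitVec := by
  constructor
  · rintro ⟨T, rfl⟩
    obtain ⟨𝓑, h, hT⟩ := T.exists_realizes r
    exact ⟨𝓑, h, hT.cone_eq⟩
  · rintro ⟨𝓑, h, rfl⟩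
    obtain ⟨T, hT⟩ := h.exists_combType hn
    exact ⟨T, hT.cone_eq⟩

lemma isFan_m0nFan (hn : 3 ≤ n) : IsFan (Lam n) (m0nFan n) := by
  let r : Fin n := ⟨0, by omega⟩
  have hface : ∀ {𝓑 𝓒 : Finset (Finset (Fin n))}, IsLaminar r 𝓑 → IsLaminar r 𝓒 →
      IsFace (Lam n) (conic 𝓑 splitVec ∩ conic 𝓒 splitVec) (conic 𝓑 splitVec) := fun h h' => by
    rw [h.conic_inter h']
    exact h.isFace hn Finset.inter_subset_left
  refine ⟨?_, ?_, ?_, ?_, ?_⟩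
  · refine (Set.finite_range fun 𝓑 : Finset (Finset (Fin n)) => conic 𝓑 splitVec).subset ?_
    intro σ hσ
    obtain ⟨𝓑, -, rfl⟩ := (mem_m0nFan_iff hn r).1 hσ
    exact ⟨𝓑, rfl⟩
  · intro σ hσ
    obtain ⟨𝓑, h, rfl⟩ := (mem_m0nFan_iff hn r).1 hσ
    exact (h.isFace hn subset_rfl).isCone
  · intro σ hσ τ hτ
    obtain ⟨𝓑, h, rfl⟩ := (mem_m0nFan_iff hn r).1 hσ
    obtain ⟨𝓒, h𝓒, rfl⟩ := exists_conic_of_isFace hτ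
    exact (mem_m0nFan_iff hn r).2 ⟨𝓒, h.mono h𝓒, rfl⟩
  · intro σ hσ σ' hσ'
    obtain ⟨𝓑, h, rfl⟩ := (mem_m0nFan_iff hn r).1 hσ
    obtain ⟨𝓒, h', rfl⟩ := (mem_m0nFan_iff hn r).1 hσ'
    exact hface h h'
  · intro σ hσ σ' hσ'
    obtain ⟨𝓑, h, rfl⟩ := (mem_m0nFan_iff hn r).1 hσ
    obtain ⟨𝓒, h', rfl⟩ := (mem_m0nFan_iff hn r).1 hσ'
    rw [Set.inter_comm]
    exact hface h' h

/-- A boundary point of a cone also comes from a curve: discarding the splits with coefficient zero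
leaves a laminar family, whose tree has only positive lengths. -/
lemma support_m0nFan (hn : 3 ≤ n) : support (m0nFan n) = Set.range (phi n) := by
  classical
  let r : Fin n := ⟨0, by omega⟩
  ext x
  constructor
  · rintro ⟨σ, hσ, hx⟩
    obtain ⟨𝓑, h, rfl⟩ := (mem_m0nFan_iff hn r).1 hσ
    obtain ⟨a, ha, rfl⟩ := hx
    obtain ⟨T, hT⟩ := (h.mono (Finset.filter_subset (fun A => 0 < a A) 𝓑)).exists_combType hn
    obtain ⟨len, hlen, hx⟩ := (hT (Set.Ioi 0) (∑ A ∈ 𝓑, a A • splitVec A)).2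
      ⟨a, fun A hA => (Finset.mem_filter.1 hA).2, by
        refine (Finset.sum_subset (Finset.filter_subset _ _) fun A hA hA' => ?_).symm
        have : ¬ 0 < a A := fun hpos => hA' (Finset.mem_filter.2 ⟨hA, hpos⟩)
        rw [le_antisymm (not_lt.1 this) (ha A hA), zero_smul]⟩
    exact ⟨Quotient.mk _ ⟨T, len, hlen⟩, hx.symm⟩
  · rintro ⟨C, rfl⟩
    induction C using Quotient.inductionOn with
    | _ C => exact ⟨C.cone, ⟨C.toCombType, rfl⟩, C.len, fun e he => (C.len_pos e he).le, rfl⟩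

end TropM0n

/-! ### The forgetful map as a morphism of fans -/

theorem proposition3p12 (n : ℕ) (hn : 3 ≤ n) :
    (∀ C : TropM0n.M0n (n + 1),
      TropM0n.prQ n (TropM0n.phi (n + 1) C) = TropM0n.phi n (TropM0n.ft hn C)) ∧
    (∀ x ∈ TropM0n.Lam (n + 1), TropM0n.prQ n x ∈ TropM0n.Lam n) ∧
    TropM0n.support (TropM0n.m0nFan (n + 1)) = Set.range (TropM0n.phi (n + 1)) ∧
    TropM0n.support (TropM0n.m0nFan n) = Set.range (TropM0n.phi n) ∧
    ∃ f : TropM0n.support (TropM0n.m0nFan (n + 1)) → TropM0n.support (TropM0n.m0nFan n),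
      (∀ (C : TropM0n.M0n (n + 1))
        (hC : TropM0n.phi (n + 1) C ∈ TropM0n.support (TropM0n.m0nFan (n + 1))),
        (f ⟨TropM0n.phi (n + 1) C, hC⟩ : TropM0n.Q n) = TropM0n.phi n (TropM0n.ft hn C)) ∧
      (∀ x, (f x : TropM0n.Q n) = TropM0n.prQ n x) ∧
      TropM0n.IsFanMorphism (TropM0n.Lam (n + 1)) (TropM0n.m0nFan (n + 1))
        (TropM0n.Lam n) (TropM0n.m0nFan n) f := by
  have hn' : 3 ≤ n + 1 := by omega
  -- Both supports consist of the images of curves, so the relation between `prQ`, `phi` and `ft`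
  -- shows that `prQ` maps one support into the other.
  have hmaps : ∀ x ∈ TropM0n.support (TropM0n.m0nFan (n + 1)),
      TropM0n.prQ n x ∈ TropM0n.support (TropM0n.m0nFan n) := by
    intro x hx
    rw [TropM0n.support_m0nFan hn'] at hx
    rw [TropM0n.support_m0nFan hn]
    obtain ⟨C, rfl⟩ := hx
    exact ⟨_, (TropM0n.prQ_phi hn C).symm⟩
  exact ⟨TropM0n.prQ_phi hn, fun x hx => TropM0n.prQ_mem_Lam hx, TropM0n.support_m0nFan hn',
    TropM0n.support_m0nFan hn, fun x => ⟨TropM0n.prQ n x, hmaps x x.2⟩,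
    fun C _ => TropM0n.prQ_phi hn C, fun _ => rfl,
    TropM0n.isLattice_Lam hn', TropM0n.isLattice_Lam hn, TropM0n.isFan_m0nFan hn',
    TropM0n.isFan_m0nFan hn, TropM0n.prQ n, fun x hx => TropM0n.prQ_mem_Lam hx, fun _ => rfl⟩
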